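/- All graphs are finite multigraphs without loops. The resistance $r(G)$ of a graph $G$ is the minimum number of edges that have to be removed from $G$ to obtain a graph with a proper edge-coloring with $\Delta(G)$ colors. A $d$-factor of $G$ is a spanning $d$-regular subgraph, and a 2-factorization of $G$ is a decomposition of $E(G)$ into 2-factors. The oddness $\xi(G)$ of an $s$-regular graph $G$ is, for even $s$, the minimum number of odd cycles in a 2-factorization of $G$ and, for odd $s$, the minimum of $\xi(G-E(F_1))$ over all 1-factors $F_1$ of $G$ (infinite if there is none). An $s$-graph is an $s$-regular graph $G$ such that every $X\subseteq V(G)$ with $|X|$ odd is joined to $V(G)\setminus X$ by at least $s$ edges. The Meredith graph $M_s$ ($s\ge 3$) is obtained from the Petersen graph by adding $s-3$ copies of one of its 1-factors. Lemma. For every integer $k\ge1$ and every integer $s\ge3$ there is a connected $s$-graph $O_k$ with $$r(O_k)=2k+1=\xi(O_k)-1 .$$ Moreover, $O_k$ can be chosen as follows: for a suitable edge $e=vw$ of $M_s$ that has no parallel edge, take $2k+1$ disjoint copies of $M_s-e$, indexed by $0,\dots,2k$, let $v_i,w_i$ be the copies of $v,w$ in the $i$-th one, and add the edges $v_{2j}v_{2j+1}$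 and $w_{2j+1}w_{2j+2}$ for $0\le j\le k-1$ and the edge $v_{2k}w_0$. -/

import Mathlib

/-! Multigraphs are Mathlib's `Graph α β` (vertices in `α`, edges in `β`). All notions below are
meant for finite loopless multigraphs. -/

namespace Graph

variable {α β : Type*}

/-- The degree of a vertex of a finite loopless multigraph: the number of edges incident to it. -/
noncomputable def degree (G : Graph α β) (x : α) : ℕ := (G.incidenceSet x).ncard

/-- The maximum degree `Δ(G)` of a finite multigraph. -/
noncomputable def maxDegree (G : Graph α β) : ℕ := sSup (G.degree '' V(G))

/-- `G` is `d`-regular. -/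
def IsRegular (G : Graph α β) (d : ℕ) : Prop := ∀ x ∈ V(G), G.degree x = d

/-- `G` is connected: it has a vertex, and any two vertices are joined by a walk. -/
def Connected (G : Graph α β) : Prop :=
  V(G).Nonempty ∧ ∀ x ∈ V(G), ∀ y ∈ V(G), Relation.ReflTransGen G.Adj x y

/-- `G` has a proper edge-coloring with (at most) `k` colors. -/
def EdgeColorable (G : Graph α β) (k : ℕ) : Prop :=
  ∃ c : E(G) → Fin k, ∀ (e f : E(G)) (x : α), e ≠ f → G.Inc e x → G.Inc f x → c e ≠ c f

/-- The resistance `r(G)`: the minimum number of edges that have to be removed from `G` to obtain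
a `Δ(G)`-edge-colorable graph. -/
noncomputable def resistance (G : Graph α β) : ℕ∞ :=
  sInf {n | ∃ F ⊆ E(G), (G.deleteEdges F).EdgeColorable G.maxDegree ∧ F.encard = n}

/-- `F` is a `d`-factor of `G`: a spanning `d`-regular subgraph. -/
def IsFactor (G : Graph α β) (d : ℕ) (F : Graph α β) : Prop := F ≤s G ∧ F.IsRegular d

/-- A cycle: a connected 2-regular graph (two parallel edges form a cycle of length 2). -/
def IsCycle (C : Graph α β) : Prop := C.Connected ∧ C.IsRegular 2

/-- The odd cycles contained in `G`, i.e. the subgraphs of `G` that are cycles of odd length. -/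
def oddCycles (G : Graph α β) : Set (Graph α β) := {C | C ≤ G ∧ C.IsCycle ∧ Odd E(C).ncard}

/-- The graphs `F 0, …, F (n - 1)` form a 2-factorization of `G`: they are 2-factors of `G`, and
every edge of `G` belongs to exactly one of them. -/
def IsTwoFactorization (G : Graph α β) {n : ℕ} (F : Fin n → Graph α β) : Prop :=
  (∀ i, G.IsFactor 2 (F i)) ∧ ∀ e ∈ E(G), ∃! i, e ∈ E(F i)

/-- The minimum number of odd cycles in a 2-factorization of `G`
(infinite if there is no 2-factorization). -/
noncomputable def evenOddness (G : Graph α β) : ℕ∞ :=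
  sInf {N | ∃ (n : ℕ) (F : Fin n → Graph α β),
    G.IsTwoFactorization F ∧ ∑ i, (F i).oddCycles.encard = N}

open Classical in
/-- The oddness `ξ(G)` of a regular graph `G`. If the degree is even, it is the minimum number
of odd cycles in a 2-factorization of `G`; if the degree is odd, it is the minimum of `ξ(G - F₁)`
over all 1-factors `F₁` of `G` (infinite if `G` has no 1-factor). -/
noncomputable def oddness (G : Graph α β) : ℕ∞ :=
  if Even G.maxDegree then G.evenOddness
  else sInf {N | ∃ F₁, G.IsFactor 1 F₁ ∧ (G.deleteEdges E(F₁)).evenOddness = N}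

/-- `∂_G(X)`: the set of edges of `G` joining `X` to `V(G) \ X`. -/
def edgeBoundary (G : Graph α β) (X : Set α) : Set β :=
  {e | ∃ x ∈ X, ∃ y ∈ V(G) \ X, G.IsLink e x y}

/-- `G` is an `s`-graph: a finite loopless `s`-regular multigraph such that `|∂_G(X)| ≥ s` for every
set `X` of vertices of odd cardinality. -/
structure IsSGraph (G : Graph α β) (s : ℕ) : Prop where
  finite_vertexSet : V(G).Finite
  finite_edgeSet : E(G).Finite
  loopless : G.Loopless
  regular : G.IsRegular s
  le_ncard_edgeBoundary : ∀ X ⊆ V(G), Odd X.ncard → s ≤ (G.edgeBoundary X).ncard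

/-- `e` is a simple edge of `G` with ends `v` and `w`: no other edge is parallel to it. -/
def IsSimpleEdge (G : Graph α β) (e : β) (v w : α) : Prop :=
  G.IsLink e v w ∧ ∀ f, G.IsLink f v w → f = e

/-- The first end of the `i`-th new edge of the graph `glue`: it is `v i` for even `i` and `w i`
for odd `i`. -/
def glueStart {m : ℕ} (v w : Fin m → α) (i : Fin m) : Fin m × α :=
  (i, if Even i.val then v i else w i)

/-- The second end of the new edge of the graph `glue` that enters the `i`-th copy: it is `w i` for
even `i` and `v i` for odd `i`. -/
def glueEnd {m : ℕ} (v w : Fin m → α) (i : Fin m) : Fin m × α :=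
  (i, if Even i.val then w i else v i)

/-- Given graphs `G 0, …, G (m - 1)` and an edge `e i` with ends `v i`, `w i` in each `G i`, this is
the graph obtained from the disjoint union of the graphs `G i - e i` by adding the `m` edges
`v 0 – v 1`, `w 1 – w 2`, `v 2 – v 3`, …, which run cyclically through the copies:
the last one is `v (m - 1) – w 0` if `m` is odd and `w (m - 1) – w 0` if `m` is even.
(In `Fin m`, the index after `m - 1` is `0`.) -/
def glue {m : ℕ} [NeZero m] (G : Fin m → Graph α β) (e : Fin m → β) (v w : Fin m → α)
    (h : ∀ i, (G i).IsLink (e i) (v i) (w i)) : Graph (Fin m × α) ((Fin m × β) ⊕ Fin m) where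
  vertexSet := {x | x.2 ∈ V(G x.1)}
  IsLink
    | .inl (i, f), x, y => x.1 = i ∧ y.1 = i ∧ ((G i).deleteEdges {e i}).IsLink f x.2 y.2
    | .inr i, x, y => s(x, y) = s(glueStart v w i, glueEnd v w (i + 1))
  isLink_symm := by
    rintro (⟨i, f⟩ | i) -
    · exact ⟨fun x y hxy => ⟨hxy.2.1, hxy.1, hxy.2.2.symm⟩⟩
    · exact ⟨fun x y hxy => Sym2.eq_swap.trans hxy⟩
  eq_or_eq_of_isLink_of_isLink := by
    rintro (⟨i, f⟩ | i) ⟨x₁, x₂⟩ ⟨y₁, y₂⟩ ⟨z₁, z₂⟩ ⟨t₁, t₂⟩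
    · rintro ⟨h1, h2, h3⟩ ⟨h4, h5, h6⟩
      dsimp only at h1 h2 h3 h4 h5 h6
      subst h1 h2 h4 h5
      rcases h3.left_eq_or_eq h6 with rfl | rfl
      · exact Or.inl rfl
      · exact Or.inr rfl
    · intro h1 h2
      have h3 := Sym2.eq_iff.1 (h1.trans h2.symm)
      rcases h3 with h3 | h3
      · exact Or.inl h3.1
      · exact Or.inr h3.1
  left_mem_of_isLink := by
    have key : ∀ i, (glueStart v w i).2 ∈ V(G i) ∧ (glueEnd v w i).2 ∈ V(G i) := by
      intro i
      have h1 := (h i).left_mem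
      have h2 := (h i).right_mem
      unfold glueStart glueEnd
      constructor <;> dsimp only <;> split_ifs <;> assumption
    rintro (⟨i, f⟩ | i) x y hxy
    · obtain ⟨h1, -, h3⟩ := hxy
      change x.2 ∈ V(G x.1)
      rw [h1]
      exact h3.left_mem
    · rcases Sym2.eq_iff.1 hxy with ⟨rfl, -⟩ | ⟨rfl, -⟩
      · exact (key i).1
      · exact (key (i + 1)).2

end Graph

/-- The Petersen graph. The vertices `(false, i)` form the outer 5-cycle, the vertices `(true, i)`
form the inner pentagram, and the spokes join `(false, i)` to `(true, i)`. -/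
def petersenGraph : SimpleGraph (Bool × ZMod 5) :=
  SimpleGraph.fromRel fun x y =>
    (x.1 = false ∧ y.1 = false ∧ y.2 = x.2 + 1) ∨
    (x.1 = true ∧ y.1 = true ∧ y.2 = x.2 + 2) ∨
    (x.1 = false ∧ y.1 = true ∧ y.2 = x.2)

/-- The Meredith graph `M_s` (`s ≥ 3`), obtained from the Petersen graph by adding `s - 3` copies of
the 1-factor `M`. The edges of the Petersen graph are labelled `inl p`, and the `i`-th additional
copy of an edge `p` of `M` is labelled `inr (p, i)`. -/
def meredithGraph (s : ℕ) (M : petersenGraph.Subgraph) :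
    Graph (Bool × ZMod 5) (Sym2 (Bool × ZMod 5) ⊕ (Sym2 (Bool × ZMod 5) × Fin (s - 3))) where
  vertexSet := Set.univ
  IsLink
    | .inl p, x, y => p = s(x, y) ∧ petersenGraph.Adj x y
    | .inr (p, _), x, y => p = s(x, y) ∧ M.Adj x y
  isLink_symm := by
    rintro (p | ⟨p, i⟩) -
    · exact ⟨fun x y hxy => ⟨hxy.1.trans Sym2.eq_swap, hxy.2.symm⟩⟩
    · exact ⟨fun x y hxy => ⟨hxy.1.trans Sym2.eq_swap, hxy.2.symm⟩⟩
  eq_or_eq_of_isLink_of_isLink := by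
    rintro (p | ⟨p, i⟩) x y z t h1 h2
    · rcases Sym2.eq_iff.1 (h1.1.symm.trans h2.1) with h3 | h3
      · exact Or.inl h3.1
      · exact Or.inr h3.1
    · rcases Sym2.eq_iff.1 (h1.1.symm.trans h2.1) with h3 | h3
      · exact Or.inl h3.1
      · exact Or.inr h3.1
  left_mem_of_isLink := fun _ _ _ _ => Set.mem_univ _

/-! The 1-factor of spokes is the one that is multiplied, and `outerEdge s 0` is the edge e.
Everything rests on a parity fact about one copy. Let A be a set of edges of the Meredith graph with
the same degree d at all vertices, and let o_i, n_i, t_i count its outer edges, inner edges and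
spoke copies at position i. Eliminating t gives n_i = o_i + o_{i+1} - o_{i+3}. Since n_i ≥ 0 and o_i
≤ 1, an odd sum of the o_i leaves only the pattern 11111 and the rotations of 11010. For d = 1 none
of these is possible, so a 1-factor has an even number of outer edges (`even_sum_outerCount`). For d
= 2 they describe two disjoint 5-cycles, one of which avoids e (`exists_five_cycle`). There are five
outer edges, so a partition of the edge set into 1-factors and 2-factors has a class with an odd
number of them; that class is a 2-factor with such a 5-cycle.

In the ring of m copies, handshaking shows that each class of a decomposition contains both or none
of the connecting edges at a given copy, so it closes up to a factor of the Meredith graph, with e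
in place of the two edges. The same closing works for the colors in a copy from which nothing was
deleted. Hence an s-coloring requires a deletion in every copy, which gives resistance at least m.
Likewise every copy contains a 5-cycle of some 2-factor. As the ring has 10m vertices, each 2-factor
has an even number of odd cycles, so for odd m there are at least m + 1.

Both bounds are attained: deleting one inner edge per copy permits an s-coloring, and the rim edges
together with the connecting edges form m inner pentagons and one long cycle through all copies,
while parallel spokes are paired into 2-cycles.

The ring is an s-graph because an odd set meets some copy in an odd set. The cut inside that copy
has at least s edges, and if e is one of them, an edge in the rest of the ring replaces it. -/

namespace Graph

/-! ### Regular graphs, components and odd cycles -/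

variable {α β : Type*} {G H C : Graph α β} {d : ℕ} {x y : α}

theorem IsRegular.maxDegree_eq (h : G.IsRegular d) (hne : V(G).Nonempty) : G.maxDegree = d := by
  have : G.degree '' V(G) = {d} := by
    ext n
    constructor
    · rintro ⟨x, hx, rfl⟩
      exact h x hx
    · rintro rfl
      obtain ⟨x, hx⟩ := hne
      exact ⟨x, hx, h x hx⟩
  rw [maxDegree, this, csSup_singleton]

/-- The handshaking lemma for regular loopless graphs. -/
theorem IsRegular.mul_ncard_vertexSet [Finite α] [Finite β] [G.Loopless] (h : G.IsRegular d) :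
    d * V(G).ncard = 2 * E(G).ncard := by
  classical
  have := Fintype.ofFinite α
  have := Fintype.ofFinite β
  have h1 := Finset.sum_card_bipartiteAbove_eq_sum_card_bipartiteBelow
    (fun (x : α) (e : β) => G.Inc e x) (s := V(G).toFinset) (t := E(G).toFinset)
  have h2 : ∀ e ∈ E(G).toFinset,
      (Finset.bipartiteBelow (fun (x : α) (e : β) => G.Inc e x) V(G).toFinset e).card = 2 := by
    intro e he
    obtain ⟨a, b, hab⟩ := G.exists_isLink_of_mem_edgeSet (by simpa using he)
    rw [Finset.card_eq_two]
    refine ⟨a, b, hab.ne, ?_⟩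
    ext x
    simp only [Finset.bipartiteBelow, Finset.mem_filter, Set.mem_toFinset, Finset.mem_insert,
      Finset.mem_singleton]
    constructor
    · exact fun hx => hx.2.eq_or_eq_of_isLink hab
    · rintro (rfl | rfl)
      · exact ⟨hab.left_mem, hab.inc_left⟩
      · exact ⟨hab.right_mem, hab.inc_right⟩
  have h3 : ∀ x ∈ V(G).toFinset,
      (Finset.bipartiteAbove (fun (x : α) (e : β) => G.Inc e x) E(G).toFinset x).card = d := by
    intro x hx
    rw [← h x (by simpa using hx), degree, Set.ncard_eq_toFinset_card']
    congr 1
    ext e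
    simp only [Finset.bipartiteAbove, Finset.mem_filter, Set.mem_toFinset, mem_incidenceSet]
    exact ⟨fun h => h.2, fun h => ⟨h.edge_mem, h⟩⟩
  rw [Finset.sum_congr rfl h3, Finset.sum_congr rfl h2, Finset.sum_const, Finset.sum_const,
    smul_eq_mul, smul_eq_mul, ← Set.ncard_eq_toFinset_card', ← Set.ncard_eq_toFinset_card'] at h1
  linarith

theorem reflTransGen_adj_symm (h : Relation.ReflTransGen G.Adj x y) :
    Relation.ReflTransGen G.Adj y x :=
  (Relation.ReflTransGen.stdSymm (r := G.Adj)).symm _ _ h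

/-- At a vertex of `C` the incidence sets of `C` and `H` are nested and both have size `d`. This is
why the cycles in a 2-regular graph are exactly its components. -/
theorem IsRegular.isClosedSubgraph [Finite β] (hH : H.IsRegular d) (hC : C.IsRegular d)
    (hle : C ≤ H) : C ≤c H := by
  refine .mk' hle fun e x he hx => ?_
  have : C.incidenceSet x = H.incidenceSet x :=
    Set.eq_of_subset_of_ncard_le (fun f hf => Inc.mono hle hf)
      ((hH x (hle.vertexSet_mono hx)).trans (hC x hx).symm).le
  exact ((Set.ext_iff.1 this e).2 he).edge_mem

theorem IsClosedSubgraph.mem_of_reflTransGen (hle : C ≤c H) (hx : x ∈ V(C))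
    (h : Relation.ReflTransGen H.Adj x y) : y ∈ V(C) := by
  induction h with
  | refl => exact hx
  | tail _ h ih => exact (hle.mem_iff_of_adj h).1 ih

/-- The connected component of the vertex `x`. -/
def component (H : Graph α β) (x : α) : Graph α β := H.induce {y | Relation.ReflTransGen H.Adj x y}

theorem mem_component_self : x ∈ V(H.component x) := Relation.ReflTransGen.refl

theorem component_isClosedSubgraph (hx : x ∈ V(H)) : H.component x ≤c H := by
  refine .mk' (induce_le ?_) ?_
  · intro y hy
    induction hy with
    | refl => exact hx
    | tail _ h _ => exact h.right_mem
  · rintro e y ⟨z, hz⟩ hy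
    exact ⟨y, z, hz, hy, hy.tail hz.adj⟩

theorem component_connected : (H.component x).Connected := by
  have key : ∀ y, Relation.ReflTransGen H.Adj x y →
      Relation.ReflTransGen (H.component x).Adj x y := by
    intro y hy
    induction hy with
    | refl => exact .refl
    | tail h1 h2 ih =>
      obtain ⟨e, he⟩ := h2
      exact ih.tail ⟨e, he, h1, h1.tail he.adj⟩
  exact ⟨⟨x, mem_component_self⟩, fun y hy z hz =>
    (reflTransGen_adj_symm (key y hy)).trans (key z hz)⟩

theorem IsClosedSubgraph.isRegular (hle : C ≤c H) (hH : H.IsRegular d) : C.IsRegular d := by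
  intro x hx
  rw [← hH x (hle.vertexSet_mono hx), degree, degree]
  congr 1
  ext e
  exact hle.inc_congr hx

theorem IsClosedSubgraph.eq_component (hle : C ≤c H) (hC : C.Connected) (hx : x ∈ V(C)) :
    C = H.component x := by
  have hV : V(C) = V(H.component x) := by
    ext y
    constructor
    · exact fun hy => 
        Relation.ReflTransGen.mono (fun a b (h : C.Adj a b) => h.mono hle.le) x y (hC.2 x hx y hy)
    · exact fun hy => hle.mem_of_reflTransGen hx hy
  refine Graph.ext hV fun e a b => ?_
  constructor
  · intro h
    exact ⟨h.mono hle.le, hV.subset h.left_mem, hV.subset h.right_mem⟩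
  · rintro ⟨h, ha, -⟩
    exact (hle.isLink_congr (hV.superset ha)).2 h

theorem IsCycle.eq_component [Finite β] (hH : H.IsRegular 2) (hC : C.IsCycle) (hle : C ≤ H)
    (hx : x ∈ V(C)) : C = H.component x :=
  (hH.isClosedSubgraph hC.2 hle).eq_component hC.1 hx

theorem component_isCycle (hH : H.IsRegular 2) (hx : x ∈ V(H)) : (H.component x).IsCycle :=
  ⟨component_connected, (component_isClosedSubgraph hx).isRegular hH⟩

/-- The number of odd cycles of a 2-regular graph of even order is even. -/
theorem IsRegular.even_ncard_oddCycles [Finite α] [Finite β] [H.Loopless] (hH : H.IsRegular 2)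
    (hV : Even V(H).ncard) : Even H.oddCycles.ncard := by
  classical
  have := Fintype.ofFinite α
  -- The vertices are sorted by their component. The total is even, so the number of fibres of odd
  -- size is even; the fibre of a cycle has as many vertices as the cycle has edges.
  have h1 := Finset.card_eq_sum_card_fiberwise (f := H.component) (s := V(H).toFinset)
    (t := V(H).toFinset.image H.component)
    (fun x hx => by
      simp only [Finset.coe_image, Set.coe_toFinset] at hx ⊢; exact Set.mem_image_of_mem _ hx)
  rw [← Set.ncard_eq_toFinset_card'] at h1
  rw [h1, Finset.even_sum_iff_even_card_odd] at hV
  rw [← Set.ncard_coe_finset] at hV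
  convert hV using 2
  ext C
  simp only [Finset.coe_filter, Finset.mem_image, Set.mem_toFinset, oddCycles, Set.mem_ofPred_eq]
  have hcard : C ≤ H → C.IsCycle →
      E(C).ncard = (Finset.filter (fun a => H.component a = C) V(H).toFinset).card := by
    intro hle hC
    have := Loopless.anti hle
    have h2 := hC.2.mul_ncard_vertexSet
    rw [← Nat.eq_of_mul_eq_mul_left two_pos h2, ← Set.ncard_coe_finset]
    congr 1
    ext x
    simp only [Finset.coe_filter, Set.mem_toFinset, Set.mem_ofPred_eq]
    constructor
    · exact fun hx => ⟨hle.vertexSet_mono hx, (hC.eq_component hH hle hx).symm⟩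
    · rintro ⟨-, rfl⟩
      exact mem_component_self
  constructor
  · rintro ⟨hle, hC, hodd⟩
    obtain ⟨x, hx⟩ := hC.1.1
    exact ⟨⟨x, hle.vertexSet_mono hx, (hC.eq_component hH hle hx).symm⟩, hcard hle hC ▸ hodd⟩
  · rintro ⟨⟨x, hx, rfl⟩, hodd⟩
    have hle := (component_isClosedSubgraph hx).le
    have hC := component_isCycle hH hx
    exact ⟨hle, hC, (hcard hle hC).symm ▸ hodd⟩

/-- If the vertices of a 2-regular graph are labelled such that vertices with the same label are
joined by a walk, then there are at most as many odd cycles as labels. -/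
theorem IsRegular.encard_oddCycles_le [Finite β] {ι : Type*} (hH : H.IsRegular 2)
    (l : α → ι)
    (hl : ∀ x ∈ V(H), ∀ y ∈ V(H), l x = l y → Relation.ReflTransGen H.Adj x y) :
    H.oddCycles.encard ≤ ENat.card ι := by
  -- Each odd cycle is sent to the label of a chosen vertex; equal labels put the two vertices into
  -- the same component.
  refine ENat.card_le_card_of_injective (f := fun C : H.oddCycles => l C.2.2.1.1.1.some) ?_
  rintro ⟨C, hC⟩ ⟨D, hD⟩ h
  have hx := hC.2.1.1.1.some_mem
  have hy := hD.2.1.1.1.some_mem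
  have h1 := hl _ (hC.1.vertexSet_mono hx) _ (hD.1.vertexSet_mono hy) h
  have h2 := (hH.isClosedSubgraph hC.2.1.2 hC.1).mem_of_reflTransGen hx h1
  exact Subtype.ext ((hC.2.1.eq_component hH hC.1 h2).trans (hD.2.1.eq_component hH hD.1 hy).symm)

theorem EdgeColorable.mono {k : ℕ} (hle : C ≤ H) (hH : H.EdgeColorable k) : C.EdgeColorable k := by
  obtain ⟨c, hc⟩ := hH
  refine ⟨fun e => c ⟨e, IsSubgraph.edgeSet_mono hle e.2⟩, fun e f x hef he hf => ?_⟩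
  exact hc _ _ x (by simpa [Subtype.ext_iff] using hef) (he.mono hle) (hf.mono hle)

/-- A color class is a 1-factor, so twice its size is the number of vertices, which equals the
number of edges. -/
theorem IsRegular.even_ncard_edgeSet [Finite α] [Finite β] [G.Loopless] (hG : G.IsRegular 2)
    (hc : G.EdgeColorable 2) : Even E(G).ncard := by
  obtain ⟨c, hc⟩ := hc
  set R := G.restrict {e | ∃ h : e ∈ E(G), c ⟨e, h⟩ = 0} with hR
  have hreg : R.IsRegular 1 := by
    intro x hx
    obtain ⟨e, f, hef, hi⟩ := Set.ncard_eq_two.1 (hG x hx)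
    have he : G.Inc e x := (Set.ext_iff.1 hi e).2 (by simp)
    have hf : G.Inc f x := (Set.ext_iff.1 hi f).2 (by simp)
    have hall : ∀ g, G.Inc g x → g = e ∨ g = f := fun g hg => by
      simpa using (Set.ext_iff.1 hi g).1 hg
    have hne := hc ⟨e, he.edge_mem⟩ ⟨f, hf.edge_mem⟩ x (by simpa using hef) he hf
    have key : ∀ {e f : β} (he : G.Inc e x) (hf : G.Inc f x), (∀ g, G.Inc g x → g = e ∨ g = f) →
        c ⟨e, he.edge_mem⟩ = 0 → c ⟨f, hf.edge_mem⟩ ≠ 0 → R.incidenceSet x = {e} := by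
      intro e f he hf hall h1 h2
      ext g
      simp only [mem_incidenceSet, hR, restrict_inc, Set.mem_ofPred_eq, Set.mem_singleton_iff]
      constructor
      · rintro ⟨hg, hgE, hg0⟩
        rcases hall g hg with rfl | rfl
        · rfl
        · exact absurd hg0 h2
      · rintro rfl
        exact ⟨he, he.edge_mem, h1⟩
    rw [degree, Set.ncard_eq_one]
    by_cases h0 : c ⟨e, he.edge_mem⟩ = 0
    · exact ⟨e, key he hf hall h0 (by rw [← h0]; exact hne.symm)⟩
    · exact ⟨f, key hf he (fun g hg => (hall g hg).symm) (by omega) h0⟩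
  have : R.Loopless := Loopless.anti restrict_le
  have h1 := hreg.mul_ncard_vertexSet
  have h2 := hG.mul_ncard_vertexSet
  have h3 : V(R) = V(G) := rfl
  rw [h3] at h1
  exact ⟨E(R).ncard, by omega⟩

theorem EdgeColorable.oddCycles_eq_empty [Finite α] [Finite β] [H.Loopless]
    (hH : H.EdgeColorable 2) : H.oddCycles = ∅ := by
  refine Set.eq_empty_of_forall_notMem ?_
  rintro C ⟨hle, hC, hodd⟩
  have := Loopless.anti hle
  exact Nat.not_even_iff_odd.2 hodd (hC.2.even_ncard_edgeSet (hH.mono hle))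

/-- A cyclic sequence of distinct vertices such that consecutive ones are linked by an edge yields
a cycle. -/
theorem exists_mem_oddCycles {n : ℕ} (hn : 3 ≤ n) (hodd : Odd n) (y : ZMod n → α)
    (hy : Function.Injective y) (g : ZMod n → β) (hg : ∀ i, G.IsLink (g i) (y i) (y (i + 1))) :
    ∃ C ∈ G.oddCycles, V(C) = Set.range y := by
  have : NeZero n := ⟨by omega⟩
  have : Fact (1 < n) := ⟨by omega⟩
  -- This is where `3 ≤ n` enters: if `g i = g j` with the ends interchanged, then `i = j + 1` and
  -- `j = i + 1`, hence `2 = 0`.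
  have h2 : (1 + 1 : ZMod n) ≠ 0 := by
    intro h
    have h3 : ((2 : ℕ) : ZMod n) = 0 := by push_cast; rw [← h]; norm_num
    rw [ZMod.natCast_eq_zero_iff] at h3
    exact absurd (Nat.le_of_dvd two_pos h3) (by omega)
  have hginj : Function.Injective g := by
    intro i j hij
    rcases (hg i).left_eq_or_eq (hij ▸ hg j) with h | h
    · exact hy h
    · rcases (hg i).eq_and_eq_or_eq_and_eq (hij ▸ hg j) with h3 | h3
      · exact hy h3.1
      · have h4 := hy h3.1
        have h5 := hy h3.2
        rw [h4, add_assoc] at h5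
        exact absurd (by simpa using h5) h2
  set C := (G.restrict (Set.range g)).induce (Set.range y) with hCdef
  have hV : V(C) = Set.range y := rfl
  have hlink : ∀ i, C.IsLink (g i) (y i) (y (i + 1)) := fun i =>
    ⟨⟨⟨i, rfl⟩, hg i⟩, ⟨i, rfl⟩, ⟨i + 1, rfl⟩⟩
  have hle : C ≤ G := by
    refine (induce_le ?_).trans restrict_le
    rintro _ ⟨i, rfl⟩
    exact (hg i).left_mem
  have hE : E(C) = Set.range g := by
    ext e
    constructor
    · intro he
      obtain ⟨a, b, h, -⟩ := C.exists_isLink_of_mem_edgeSet he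
      exact h.1
    · rintro ⟨i, rfl⟩
      exact (hlink i).edge_mem
  refine ⟨C, ⟨hle, ⟨⟨⟨y 0, 0, rfl⟩, ?_⟩, ?_⟩, ?_⟩, hV⟩
  · have key : ∀ j : ℕ, Relation.ReflTransGen C.Adj (y 0) (y j) := by
      intro j
      induction j with
      | zero => simpa using .refl
      | succ j ih => exact ih.tail ⟨g j, by simpa using hlink j⟩
    have key' : ∀ j, Relation.ReflTransGen C.Adj (y 0) (y j) := fun j => by
      simpa using key j.val
    rintro _ ⟨i, rfl⟩ _ ⟨j, rfl⟩
    exact (reflTransGen_adj_symm (key' i)).trans (key' j)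
  · rintro _ ⟨i, rfl⟩
    have : C.incidenceSet (y i) = {g i, g (i - 1)} := by
      ext e
      constructor
      · intro he
        obtain ⟨j, rfl⟩ : e ∈ Set.range g := hE ▸ he.edge_mem
        rcases he.eq_or_eq_of_isLink (hlink j) with h | h
        · exact Or.inl (by rw [hy h])
        · right
          rw [hy h]
          simp
      · rintro (rfl | rfl)
        · exact (hlink i).inc_left
        · have := (hlink (i - 1)).inc_right
          rwa [sub_add_cancel] at this
    rw [degree, this, Set.ncard_pair]
    intro h
    exact one_ne_zero (sub_eq_self.1 (hginj h).symm)
  · rw [hE, Set.ncard_range_of_injective hginj, Nat.card_zmod]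
    exact hodd

end Graph

/-! ### The ring of copies: degrees, connectedness, odd cuts -/

namespace Graph

variable {α β : Type*} {G : Graph α β} {e g : β} {v w x y : α} {m d s : ℕ}

/-- The graph obtained by gluing `m` copies of `G - e` cyclically, where `e = vw`. -/
def ring (m : ℕ) [NeZero m] (h : G.IsLink e v w) : Graph (Fin m × α) ((Fin m × β) ⊕ Fin m) :=
  glue (fun _ => G) (fun _ => e) (fun _ => v) (fun _ => w) (fun _ => h)

/-- The first end of the `i`-th connecting edge of `ring`. -/
def ringStart (v w : α) (i : Fin m) : Fin m × α := glueStart (fun _ => v) (fun _ => w) i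

/-- The end in the `i`-th copy of the connecting edge of `ring` entering that copy. -/
def ringEnd (v w : α) (i : Fin m) : Fin m × α := glueEnd (fun _ => v) (fun _ => w) i

theorem ringStart_ringEnd (v w : α) (i : Fin m) :
    (ringStart v w i = (i, v) ∧ ringEnd v w i = (i, w)) ∨
      (ringStart v w i = (i, w) ∧ ringEnd v w i = (i, v)) := by
  unfold ringStart ringEnd glueStart glueEnd
  split_ifs <;> simp

theorem ringStart_eq_or (v w : α) (i : Fin m) :
    ringStart v w i = (i, v) ∨ ringStart v w i = (i, w) := by
  rcases ringStart_ringEnd v w i with h | h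
  · exact Or.inl h.1
  · exact Or.inr h.1

theorem ringEnd_eq_or (v w : α) (i : Fin m) :
    ringEnd v w i = (i, v) ∨ ringEnd v w i = (i, w) := by
  rcases ringStart_ringEnd v w i with h | h
  · exact Or.inr h.2
  · exact Or.inl h.2

theorem ringStart_ne_ringEnd (hvw : v ≠ w) (i : Fin m) : ringStart v w i ≠ ringEnd v w i := by
  rcases ringStart_ringEnd v w i with h | h
  · rw [h.1, h.2]; simpa using hvw
  · rw [h.1, h.2]; simpa using hvw.symm

variable [NeZero m]

open Classical in
/-- The edge of `ring` at the vertex `(i, x)` which corresponds to the edge `g` of `G` at `x`. -/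
noncomputable def copyEdge (e : β) (v w : α) (i : Fin m) (x : α) (g : β) : (Fin m × β) ⊕ Fin m :=
  if g = e then .inr (if (i, x) = ringStart v w i then i else i - 1) else .inl (i, g)

theorem copyEdge_of_ne {i : Fin m} (h : g ≠ e) : copyEdge e v w i x g = .inl (i, g) := by
  simp [copyEdge, h]

theorem copyEdge_injective (e : β) (v w : α) (i : Fin m) (x : α) :
    Function.Injective (copyEdge e v w i x) := by
  intro g g' h
  unfold copyEdge at h
  split_ifs at h <;> simp_all

section ring

variable (h : G.IsLink e v w)

theorem ring_isLink_inl {i : Fin m} {p q : Fin m × α} :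
    (ring m h).IsLink (.inl (i, g)) p q ↔ p.1 = i ∧ q.1 = i ∧ G.IsLink g p.2 q.2 ∧ g ≠ e := Iff.rfl

theorem ring_isLink_inl_mk {i : Fin m} :
    (ring m h).IsLink (.inl (i, g)) (i, x) (i, y) ↔ G.IsLink g x y ∧ g ≠ e := by
  simp [ring_isLink_inl]

theorem ring_isLink_inr {i : Fin m} {p q : Fin m × α} :
    (ring m h).IsLink (.inr i) p q ↔ s(p, q) = s(ringStart v w i, ringEnd v w (i + 1)) := Iff.rfl

theorem ring_isLink_ringStart (i : Fin m) :
    (ring m h).IsLink (.inr i) (ringStart v w i) (ringEnd v w (i + 1)) := rfl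

/-- `copyEdge` identifies the edges of `G` at `x` with the edges of the ring at `(i, x)`; at an end
of `e`, the connecting edge takes the place of `e`. -/
theorem ring_inc_iff (hvw : v ≠ w) {i : Fin m} {f : (Fin m × β) ⊕ Fin m} :
    (ring m h).Inc f (i, x) ↔ ∃ g, G.Inc g x ∧ copyEdge e v w i x g = f := by
  constructor
  · rintro ⟨y, hy⟩
    rcases f with ⟨i', g⟩ | j
    · obtain ⟨rfl, -, h3, h4⟩ := (ring_isLink_inl h).1 hy
      exact ⟨g, h3.inc_left, copyEdge_of_ne h4⟩
    · have hev : ∀ {x}, (i, x) = (i, v) ∨ (i, x) = (i, w) → G.Inc e x := by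
        rintro x (hx | hx)
        · rw [(Prod.mk.inj hx).2]; exact h.inc_left
        · rw [(Prod.mk.inj hx).2]; exact h.inc_right
      rcases Sym2.eq_iff.1 ((ring_isLink_inr h).1 hy) with ⟨h1, -⟩ | ⟨h1, -⟩
      · have hij : i = j := congrArg Prod.fst h1
        subst hij
        refine ⟨e, hev (h1 ▸ ringStart_eq_or v w i), ?_⟩
        simp [copyEdge, h1]
      · have hij : i = j + 1 := congrArg Prod.fst h1
        subst hij
        refine ⟨e, hev (h1 ▸ ringEnd_eq_or v w _), ?_⟩
        simp [copyEdge, h1, (ringStart_ne_ringEnd hvw _).symm]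
  · rintro ⟨g, hg, rfl⟩
    by_cases hge : g = e
    · subst hge
      unfold copyEdge
      rw [if_pos rfl]
      split_ifs with hs
      · rw [hs]
        exact (ring_isLink_ringStart h i).inc_left
      · have : (i, x) = ringEnd v w i := by
          have := hg.eq_or_eq_of_isLink h
          rcases ringStart_ringEnd v w i with ⟨h1, h2⟩ | ⟨h1, h2⟩ <;> rw [h1] at hs <;>
            rw [h2] <;> simp_all
        rw [this]
        have := (ring_isLink_ringStart h (i - 1)).inc_right
        rwa [sub_add_cancel] at this
    · rw [copyEdge_of_ne hge]
      obtain ⟨y, hy⟩ := hg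
      exact ⟨(i, y), (ring_isLink_inl_mk h).2 ⟨hy, hge⟩⟩

/-- With `B` arbitrary, the degrees of any factor of the ring become counts in a single copy of `G`;
`B = univ` gives the degrees of the ring itself. -/
theorem ncard_ring_inc (hvw : v ≠ w) (B : Set ((Fin m × β) ⊕ Fin m)) (i : Fin m) (x : α) :
    {f | (ring m h).Inc f (i, x) ∧ f ∈ B}.ncard =
      {g | G.Inc g x ∧ copyEdge e v w i x g ∈ B}.ncard := by
  rw [← Set.ncard_image_of_injective _ (copyEdge_injective e v w i x)]
  congr 1
  ext f
  simp only [ring_inc_iff h hvw, Set.mem_ofPred_eq, Set.mem_image]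
  constructor
  · rintro ⟨⟨g, hg, rfl⟩, hB⟩
    exact ⟨g, ⟨hg, hB⟩, rfl⟩
  · rintro ⟨g, ⟨hg, hB⟩, rfl⟩
    exact ⟨⟨g, hg, rfl⟩, hB⟩

theorem degree_ring (hvw : v ≠ w) (i : Fin m) (x : α) :
    (ring m h).degree (i, x) = G.degree x := by
  simpa [degree, incidenceSet] using ncard_ring_inc h hvw Set.univ i x

theorem isRegular_ring (hvw : v ≠ w) (hG : G.IsRegular d) : (ring m h).IsRegular d :=
  fun ⟨i, x⟩ hx => (degree_ring h hvw i x).trans (hG x hx)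

theorem inl_mem_edgeSet_ring {i : Fin m} : .inl (i, g) ∈ E(ring m h) ↔ g ∈ E(G) ∧ g ≠ e := by
  constructor
  · intro hg
    obtain ⟨p, q, hpq⟩ := exists_isLink_of_mem_edgeSet hg
    obtain ⟨-, -, h3, h4⟩ := (ring_isLink_inl h).1 hpq
    exact ⟨h3.edge_mem, h4⟩
  · rintro ⟨hg, hne⟩
    obtain ⟨p, q, hpq⟩ := exists_isLink_of_mem_edgeSet hg
    exact ((ring_isLink_inl_mk h (i := i)).2 ⟨hpq, hne⟩).edge_mem

theorem inr_mem_edgeSet_ring (i : Fin m) : .inr i ∈ E(ring m h) :=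
  (ring_isLink_ringStart h i).edge_mem

theorem loopless_ring (hm : 2 ≤ m) [G.Loopless] : (ring m h).Loopless := by
  refine ⟨?_⟩
  rintro (⟨i, g⟩ | i) ⟨j, x⟩ hl
  · exact ((ring_isLink_inl h).1 hl).2.2.1.ne rfl
  · have h1 := Sym2.eq_iff.1 ((ring_isLink_inr h).1 hl)
    have h2 : i = i + 1 := by
      rcases h1 with ⟨h1, h2⟩ | ⟨h1, h2⟩
      · exact (congrArg Prod.fst h1).symm.trans (congrArg Prod.fst h2)
      · exact (congrArg Prod.fst h2).symm.trans (congrArg Prod.fst h1)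
    have : Nontrivial (Fin m) := Fin.nontrivial_iff_two_le.2 hm
    have h3 : (1 : Fin m) = 0 := by simpa using h2
    have h4 := congrArg Fin.val h3
    rw [Fin.val_one', Nat.mod_eq_of_lt hm] at h4
    simp at h4

open Fin.CommRing in
/-- A transitive relation holding along the connecting edges and through some consecutive
copies holds between the first and the last of the corresponding vertices. -/
theorem ring_rel_of_forall_le {r : Fin m × α → Fin m × α → Prop}
    (trans : ∀ a b c, r a b → r b c → r a c)
    (hring : ∀ i, r (ringStart v w i) (ringEnd v w (i + 1))) (i : Fin m) (n : ℕ)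
    (hcopy : ∀ l : ℕ, 1 ≤ l → l ≤ n → r (ringEnd v w (i + l)) (ringStart v w (i + l))) :
    r (ringStart v w i) (ringEnd v w (i + n + 1)) := by
  induction n with
  | zero => simpa using hring i
  | succ n ih =>
    have h1 := ih fun l h1 h2 => hcopy l h1 (by omega)
    have h2 := hcopy (n + 1) (by omega) le_rfl
    have h3 := hring (i + (n + 1 : ℕ))
    push_cast at h2 h3 ⊢
    rw [add_assoc] at h1
    exact trans _ _ _ h1 (trans _ _ _ h2 h3)

open Fin.CommRing in
-- From the exit of copy `i` the ring leads through the other `m - 1` copies back to the entrance of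
-- copy `i`. Since `r` is arbitrary, it can be taken to mean "on the same side of a cut".
theorem ring_rel_of_forall_ne {r : Fin m × α → Fin m × α → Prop}
    (trans : ∀ a b c, r a b → r b c → r a c)
    (hring : ∀ i, r (ringStart v w i) (ringEnd v w (i + 1))) (i : Fin m)
    (hcopy : ∀ j ≠ i, r (ringEnd v w j) (ringStart v w j)) :
    r (ringStart v w i) (ringEnd v w i) := by
  have hm : 0 < m := Nat.pos_of_neZero m
  have h1 := ring_rel_of_forall_le trans hring i (m - 1) fun l h1 h2 => hcopy _ fun h3 => by
    rw [add_eq_left, Fin.natCast_eq_zero] at h3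
    exact absurd (Nat.le_of_dvd (by omega) h3) (by omega)
  have h2 : ((m - 1 : ℕ) : Fin m) + 1 = 0 := by
    have : ((m - 1 + 1 : ℕ) : Fin m) = 0 := by
      rw [Fin.natCast_eq_zero, Nat.sub_add_cancel hm]
    simpa using this
  rwa [add_assoc, h2, add_zero] at h1

open Fin.CommRing in
theorem ring_rel_of_forall {r : Fin m × α → Fin m × α → Prop}
    (trans : ∀ a b c, r a b → r b c → r a c)
    (hring : ∀ i, r (ringStart v w i) (ringEnd v w (i + 1)))
    (hcopy : ∀ j, r (ringEnd v w j) (ringStart v w j)) (i j : Fin m) :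
    r (ringStart v w i) (ringStart v w j) := by
  have h1 := ring_rel_of_forall_le trans hring i (j - i - 1).val fun l _ _ => hcopy _
  rw [Fin.cast_val_eq_self, show i + (j - i - 1) + 1 = j by ring] at h1
  exact trans _ _ _ h1 (hcopy j)

theorem reflTransGen_ring (i : Fin m)
    (hxy : Relation.ReflTransGen (G.deleteEdges {e}).Adj x y) :
    Relation.ReflTransGen (ring m h).Adj (i, x) (i, y) := by
  refine Relation.ReflTransGen.lift (fun x => (i, x)) ?_ _ _ hxy
  rintro a b ⟨g, hg⟩
  exact ⟨.inl (i, g), (ring_isLink_inl_mk h).2 hg⟩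

theorem reflTransGen_ringEnd_ringStart (hG : (G.deleteEdges {e}).Connected) (j : Fin m) :
    Relation.ReflTransGen (ring m h).Adj (ringEnd v w j) (ringStart v w j) := by
  have h1 := reflTransGen_ring h j (hG.2 v h.left_mem w h.right_mem)
  rcases ringStart_ringEnd v w j with ⟨h2, h3⟩ | ⟨h2, h3⟩ <;> rw [h2, h3]
  · exact reflTransGen_adj_symm h1
  · exact h1

theorem connected_ring (hG : (G.deleteEdges {e}).Connected) : (ring m h).Connected := by
  have key : ∀ i x, x ∈ V(G) →
      Relation.ReflTransGen (ring m h).Adj (ringStart v w 0) (i, x) := by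
    intro i x hx
    have h1 := ring_rel_of_forall (r := Relation.ReflTransGen (ring m h).Adj)
      (fun _ _ _ h1 h2 => h1.trans h2)
      (fun i => .single (ring_isLink_ringStart h i).adj)
      (reflTransGen_ringEnd_ringStart h hG) 0 i
    refine h1.trans ?_
    rcases ringStart_eq_or v w i with h2 | h2 <;> rw [h2]
    · exact reflTransGen_ring h i (hG.2 v h.left_mem x hx)
    · exact reflTransGen_ring h i (hG.2 w h.right_mem x hx)
  refine ⟨⟨(0, v), h.left_mem⟩, ?_⟩
  rintro ⟨i, x⟩ hx ⟨j, y⟩ hy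
  exact (reflTransGen_adj_symm (key i x hx)).trans (key j y hy)

/-- If `X` separates the ends of `e` in copy `i`, then it also has to cut the path that joins them
around the rest of the ring. That path exists because `G - e` is connected in every other copy, and
it uses no edge of copy `i`. -/
theorem exists_mem_edgeBoundary_ring (hG : (G.deleteEdges {e}).Connected)
    {X : Set (Fin m × α)} {i : Fin m} (hi : e ∈ G.edgeBoundary {x | (i, x) ∈ X}) :
    ∃ f ∈ (ring m h).edgeBoundary X, ∀ g, f ≠ .inl (i, g) := by
  by_contra! hcon
  have hmem : ∀ {f p q}, (ring m h).IsLink f p q → (∀ g, f ≠ .inl (i, g)) → (p ∈ X ↔ q ∈ X) := by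
    intro f p q hpq hf
    by_contra hne
    have : f ∈ (ring m h).edgeBoundary X := by
      by_cases hp : p ∈ X
      · exact ⟨p, hp, q, ⟨hpq.right_mem, fun hq => hne (by simp [hp, hq])⟩, hpq⟩
      · exact ⟨q, by tauto, p, ⟨hpq.left_mem, hp⟩, hpq.symm⟩
    obtain ⟨g, hg⟩ := hcon f this
    exact hf g hg
  have hcopy : ∀ j ≠ i, (ringEnd v w j ∈ X ↔ ringStart v w j ∈ X) := by
    intro j hj
    have h1 : ∀ y, Relation.ReflTransGen (G.deleteEdges {e}).Adj v y →
        ((j, v) ∈ X ↔ (j, y) ∈ X) := by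
      intro y hy
      induction hy with
      | refl => rfl
      | tail _ h2 ih =>
        obtain ⟨g, hg⟩ := h2
        exact ih.trans (hmem ((ring_isLink_inl_mk h (i := j)).2 hg) fun g' hg' => by simp_all)
    have h2 := h1 w (hG.2 v h.left_mem w h.right_mem)
    rcases ringStart_ringEnd v w j with ⟨h3, h4⟩ | ⟨h3, h4⟩ <;> rw [h3, h4]
    · exact h2.symm
    · exact h2
  have h1 := ring_rel_of_forall_ne (r := fun p q => (p ∈ X ↔ q ∈ X))
    (fun _ _ _ h1 h2 => h1.trans h2)
    (fun i => hmem (ring_isLink_ringStart h i) (by simp)) i hcopy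
  have h2 : (i, v) ∈ X ↔ (i, w) ∈ X := by
    rcases ringStart_ringEnd v w i with ⟨h3, h4⟩ | ⟨h3, h4⟩ <;> rw [h3, h4] at h1
    · exact h1
    · exact h1.symm
  obtain ⟨x, hx, y, hy, hxy⟩ := hi
  have h3 : (i, x) ∈ X := hx
  have h4 : (i, y) ∉ X := hy.2
  rcases h.eq_and_eq_or_eq_and_eq hxy with ⟨rfl, rfl⟩ | ⟨rfl, rfl⟩ <;> tauto

/-- Some copy meets `X` in an odd set. The cut edges of `G` in that copy inject into the boundary of
`X`, where `e`, if it is cut, is sent to an edge outside the copy. -/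
theorem isSGraph_ring [Finite α] [Finite β] (hm : 2 ≤ m) (hs : G.IsSGraph s)
    (hG : (G.deleteEdges {e}).Connected) : (ring m h).IsSGraph s := by
  classical
  have := hs.loopless
  refine ⟨Set.toFinite _, Set.toFinite _, loopless_ring h hm, isRegular_ring h h.ne hs.regular, ?_⟩
  intro X hX hodd
  obtain ⟨i, hi⟩ : ∃ i, Odd {x | (i, x) ∈ X}.ncard := by
    have := Fintype.ofFinite α
    by_contra! hcon
    have h1 := Finset.card_eq_sum_card_fiberwise (f := Prod.fst) (s := X.toFinset)
      (t := (Finset.univ : Finset (Fin m))) (fun _ _ => by simp)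
    rw [← Set.ncard_eq_toFinset_card'] at h1
    rw [h1, ← Nat.not_even_iff_odd] at hodd
    refine hodd (Finset.even_sum _ fun i _ => ?_)
    have h2 := hcon i
    rw [Nat.not_odd_iff_even] at h2
    suffices heq : (X.toFinset.filter fun a => a.1 = i).card = {x | (i, x) ∈ X}.ncard from heq ▸ h2
    rw [← Set.ncard_image_of_injective _ (Prod.mk_right_injective i), ← Set.ncard_coe_finset]
    congr 1
    ext ⟨j, x⟩
    simp only [Finset.coe_filter, Set.mem_toFinset, Set.mem_ofPred_eq, Set.mem_image,
      Prod.mk.injEq]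
    constructor
    · rintro ⟨h3, rfl⟩
      exact ⟨x, h3, rfl, rfl⟩
    · rintro ⟨_, h3, rfl, rfl⟩
      exact ⟨h3, rfl⟩
  refine (hs.le_ncard_edgeBoundary _ (fun x hx => hX hx) hi).trans ?_
  have key : ∀ g ∈ G.edgeBoundary {x | (i, x) ∈ X}, g ≠ e →
      .inl (i, g) ∈ (ring m h).edgeBoundary X := by
    rintro g ⟨x, hx, y, hy, hxy⟩ hg
    exact ⟨(i, x), hx, (i, y), hy, (ring_isLink_inl_mk h).2 ⟨hxy, hg⟩⟩
  by_cases he : e ∈ G.edgeBoundary {x | (i, x) ∈ X}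
  · obtain ⟨f, hf, hfi⟩ := exists_mem_edgeBoundary_ring h hG he
    refine Set.ncard_le_ncard_of_injOn (fun g => if g = e then f else .inl (i, g)) ?_ ?_
    · intro g hg
      split_ifs with hge
      · exact hf
      · exact key g hg hge
    · intro g hg g' hg' hgg
      dsimp only at hgg
      split_ifs at hgg with h1 h2 h2
      · rw [h1, h2]
      · exact absurd hgg (hfi _)
      · exact absurd hgg.symm (hfi _)
      · simpa using hgg
  · refine Set.ncard_le_ncard_of_injOn (fun g => .inl (i, g)) ?_ ?_
    · intro g hg
      exact key g hg fun h => he (h ▸ hg)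
    · intro g hg g' hg' hgg
      simpa using hgg

end ring

end Graph

/-! ### The Petersen and Meredith graphs: edges, incidences, degrees -/

open Graph

theorem sum_zmod_five {M : Type*} [AddCommMonoid M] (f : ZMod 5 → M) :
    ∑ i, f i = f 0 + f 1 + f 2 + f 3 + f 4 := Fin.sum_univ_five f

theorem forall_zmod_five {p : ZMod 5 → Prop} : (∀ i, p i) ↔ p 0 ∧ p 1 ∧ p 2 ∧ p 3 ∧ p 4 := by
  refine ⟨fun h => ⟨h 0, h 1, h 2, h 3, h 4⟩, fun ⟨h0, h1, h2, h3, h4⟩ i => ?_⟩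
  have : ∀ i : ZMod 5, i = 0 ∨ i = 1 ∨ i = 2 ∨ i = 3 ∨ i = 4 := by decide
  rcases this i with rfl | rfl | rfl | rfl | rfl <;> assumption

theorem petersenGraph_adj_false {i : ZMod 5} {y : Bool × ZMod 5} :
    petersenGraph.Adj (false, i) y ↔ y = (false, i + 1) ∨ y = (false, i - 1) ∨ y = (true, i) := by
  simp only [petersenGraph, SimpleGraph.fromRel_adj]
  revert i y
  decide

theorem petersenGraph_adj_true {i : ZMod 5} {y : Bool × ZMod 5} :
    petersenGraph.Adj (true, i) y ↔ y = (true, i + 2) ∨ y = (true, i - 2) ∨ y = (false, i) := by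
  simp only [petersenGraph, SimpleGraph.fromRel_adj]
  revert i y
  decide

/-- The 1-factor of the Petersen graph which consists of the spokes. -/
def petersenSpokes : petersenGraph.Subgraph where
  verts := Set.univ
  Adj x y := x.1 ≠ y.1 ∧ x.2 = y.2
  adj_sub := by
    rintro ⟨_ | _, i⟩ ⟨_ | _, j⟩ ⟨h, rfl⟩ <;>
      simp_all [petersenGraph_adj_false, petersenGraph_adj_true]
  edge_vert _ := Set.mem_univ _
  symm := ⟨fun _ _ h => ⟨h.1.symm, h.2.symm⟩⟩

theorem petersenSpokes_isPerfectMatching : petersenSpokes.IsPerfectMatching := by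
  refine ⟨fun x _ => ⟨(!x.1, x.2), ⟨by simp, rfl⟩, ?_⟩, fun _ => Set.mem_univ _⟩
  rintro ⟨b, j⟩ ⟨h1, h2⟩
  simp only at h1 h2
  ext <;> simp_all [Bool.eq_not_iff, eq_comm]

/-- The edge type of the Meredith graph. -/
abbrev MeredithEdge (s : ℕ) : Type :=
  Sym2 (Bool × ZMod 5) ⊕ (Sym2 (Bool × ZMod 5) × Fin (s - 3))

/-- The Meredith graph with multiple spokes. -/
abbrev meredith (s : ℕ) : Graph (Bool × ZMod 5) (MeredithEdge s) := meredithGraph s petersenSpokes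

/-- The edges of the outer 5-cycle. -/
def outerEdge (s : ℕ) (i : ZMod 5) : MeredithEdge s := .inl s((false, i), (false, i + 1))

/-- The edges of the inner 5-cycle. -/
def innerEdge (s : ℕ) (i : ZMod 5) : MeredithEdge s := .inl s((true, i), (true, i + 2))

/-- The parallel copies of the spokes. -/
def spokeEdge (s : ℕ) (i : ZMod 5) : Option (Fin (s - 3)) → MeredithEdge s
  | none => .inl s((false, i), (true, i))
  | some c => .inr (s((false, i), (true, i)), c)

theorem outerEdge_injective (s : ℕ) : Function.Injective (outerEdge s) := by
  intro i j h
  replace h := Sum.inl_injective h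
  revert i j
  decide

theorem innerEdge_injective (s : ℕ) : Function.Injective (innerEdge s) := by
  intro i j h
  replace h := Sum.inl_injective h
  revert i j
  decide

theorem spokeEdge_inj {s : ℕ} {i j : ZMod 5} {c d : Option (Fin (s - 3))} :
    spokeEdge s i c = spokeEdge s j d ↔ i = j ∧ c = d := by
  rcases c with _ | c <;> rcases d with _ | d <;> simp [spokeEdge]

theorem spokeEdge_injective (s : ℕ) (i : ZMod 5) : Function.Injective (spokeEdge s i) :=
  fun _ _ h => (spokeEdge_inj.1 h).2

theorem outerEdge_ne_innerEdge {s : ℕ} (i j : ZMod 5) : outerEdge s i ≠ innerEdge s j := by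
  simp [outerEdge, innerEdge]

theorem outerEdge_ne_spokeEdge {s : ℕ} (i j : ZMod 5) (c : Option (Fin (s - 3))) :
    outerEdge s i ≠ spokeEdge s j c := by
  rcases c with _ | c <;> simp [outerEdge, spokeEdge]

theorem innerEdge_ne_spokeEdge {s : ℕ} (i j : ZMod 5) (c : Option (Fin (s - 3))) :
    innerEdge s i ≠ spokeEdge s j c := by
  rcases c with _ | c <;> simp [innerEdge, spokeEdge]

section meredith

variable {s : ℕ} {g : MeredithEdge s}

theorem meredith_isLink_outerEdge (i : ZMod 5) :
    (meredith s).IsLink (outerEdge s i) (false, i) (false, i + 1) :=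
  ⟨rfl, petersenGraph_adj_false.2 (Or.inl rfl)⟩

theorem meredith_isLink_innerEdge (i : ZMod 5) :
    (meredith s).IsLink (innerEdge s i) (true, i) (true, i + 2) :=
  ⟨rfl, petersenGraph_adj_true.2 (Or.inl rfl)⟩

theorem meredith_isLink_spokeEdge (i : ZMod 5) (c : Option (Fin (s - 3))) :
    (meredith s).IsLink (spokeEdge s i c) (false, i) (true, i) := by
  rcases c with _ | c
  · exact ⟨rfl, petersenGraph_adj_false.2 (Or.inr (Or.inr rfl))⟩
  · exact ⟨rfl, by simp, rfl⟩

theorem meredith_inc_false {i : ZMod 5} :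
    (meredith s).Inc g (false, i) ↔
      g = outerEdge s i ∨ g = outerEdge s (i - 1) ∨ ∃ c, g = spokeEdge s i c := by
  constructor
  · rintro ⟨y, hy⟩
    rcases g with p | ⟨p, c⟩
    · obtain ⟨rfl, h⟩ := hy
      rcases petersenGraph_adj_false.1 h with rfl | rfl | rfl
      · exact Or.inl rfl
      · right; left
        rw [outerEdge, sub_add_cancel, Sym2.eq_swap]
      · exact Or.inr (Or.inr ⟨none, rfl⟩)
    · obtain ⟨rfl, h⟩ := hy
      rcases petersenGraph_adj_false.1 h.adj_sub with rfl | rfl | rfl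
      · exact absurd rfl h.1
      · exact absurd rfl h.1
      · exact Or.inr (Or.inr ⟨some c, rfl⟩)
  · rintro (rfl | rfl | ⟨c, rfl⟩)
    · exact (meredith_isLink_outerEdge i).inc_left
    · have := (meredith_isLink_outerEdge (s := s) (i - 1)).inc_right
      rwa [sub_add_cancel] at this
    · exact (meredith_isLink_spokeEdge i c).inc_left

theorem meredith_inc_true {i : ZMod 5} :
    (meredith s).Inc g (true, i) ↔
      g = innerEdge s i ∨ g = innerEdge s (i - 2) ∨ ∃ c, g = spokeEdge s i c := by
  constructor
  · rintro ⟨y, hy⟩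
    rcases g with p | ⟨p, c⟩
    · obtain ⟨rfl, h⟩ := hy
      rcases petersenGraph_adj_true.1 h with rfl | rfl | rfl
      · exact Or.inl rfl
      · right; left
        rw [innerEdge, sub_add_cancel, Sym2.eq_swap]
      · exact Or.inr (Or.inr ⟨none, by rw [spokeEdge, Sym2.eq_swap]⟩)
    · obtain ⟨rfl, h⟩ := hy
      rcases petersenGraph_adj_true.1 h.adj_sub with rfl | rfl | rfl
      · exact absurd rfl h.1
      · exact absurd rfl h.1
      · exact Or.inr (Or.inr ⟨some c, by rw [spokeEdge, Sym2.eq_swap]⟩)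
  · rintro (rfl | rfl | ⟨c, rfl⟩)
    · exact (meredith_isLink_innerEdge i).inc_left
    · have := (meredith_isLink_innerEdge (s := s) (i - 2)).inc_right
      rwa [sub_add_cancel] at this
    · exact (meredith_isLink_spokeEdge i c).inc_right

theorem mem_edgeSet_meredith :
    g ∈ E(meredith s) ↔ (∃ i, g = outerEdge s i) ∨ (∃ i, g = innerEdge s i) ∨
      ∃ i c, g = spokeEdge s i c := by
  constructor
  · intro hg
    obtain ⟨⟨b, i⟩, y, hxy⟩ := exists_isLink_of_mem_edgeSet hg
    cases b
    · rcases meredith_inc_false.1 hxy.inc_left with h | h | ⟨c, h⟩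
      · exact Or.inl ⟨_, h⟩
      · exact Or.inl ⟨_, h⟩
      · exact Or.inr (Or.inr ⟨_, _, h⟩)
    · rcases meredith_inc_true.1 hxy.inc_left with h | h | ⟨c, h⟩
      · exact Or.inr (Or.inl ⟨_, h⟩)
      · exact Or.inr (Or.inl ⟨_, h⟩)
      · exact Or.inr (Or.inr ⟨_, _, h⟩)
  · rintro (⟨i, rfl⟩ | ⟨i, rfl⟩ | ⟨i, c, rfl⟩)
    · exact (meredith_isLink_outerEdge i).edge_mem
    · exact (meredith_isLink_innerEdge i).edge_mem
    · exact (meredith_isLink_spokeEdge i c).edge_mem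

open Classical in
-- The local picture at a vertex of the Meredith graph: two rim edges `a`, `b` and a bundle `f` of
-- parallel spokes. The set `A` will be a factor or a color class.
theorem ncard_eq_or_eq_or_exists {β ι : Type*} [Finite ι] {a b : β} {f : ι → β} (hab : a ≠ b)
    (hf : Function.Injective f) (ha : ∀ i, a ≠ f i) (hb : ∀ i, b ≠ f i) (A : Set β) :
    {g | (g = a ∨ g = b ∨ ∃ i, g = f i) ∧ g ∈ A}.ncard =
      (if a ∈ A then 1 else 0) + (if b ∈ A then 1 else 0) + {i | f i ∈ A}.ncard := by
  have h1 : ∀ c : β, ({c} ∩ A).ncard = if c ∈ A then 1 else 0 := by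
    intro c
    split_ifs with h
    · rw [Set.inter_eq_left.2 (Set.singleton_subset_iff.2 h), Set.ncard_singleton]
    · rw [Set.singleton_inter_eq_empty.2 h, Set.ncard_empty]
  have h2 : {g | (g = a ∨ g = b ∨ ∃ i, g = f i) ∧ g ∈ A} =
      ({a} ∩ A) ∪ ({b} ∩ A) ∪ f '' {i | f i ∈ A} := by
    ext g
    simp only [Set.mem_ofPred_eq, Set.mem_union, Set.mem_inter_iff, Set.mem_singleton_iff,
      Set.mem_image]
    constructor
    · rintro ⟨rfl | rfl | ⟨i, rfl⟩, hA⟩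
      · exact Or.inl (Or.inl ⟨rfl, hA⟩)
      · exact Or.inl (Or.inr ⟨rfl, hA⟩)
      · exact Or.inr ⟨i, hA, rfl⟩
    · rintro ((⟨rfl, hA⟩ | ⟨rfl, hA⟩) | ⟨i, hA, rfl⟩)
      · exact ⟨Or.inl rfl, hA⟩
      · exact ⟨Or.inr (Or.inl rfl), hA⟩
      · exact ⟨Or.inr (Or.inr ⟨i, rfl⟩), hA⟩
  have hfa : ∀ c : β, ({c} ∩ A).Finite := fun c => (Set.finite_singleton c).inter_of_left A
  rw [h2, Set.ncard_union_eq ?_ ((hfa a).union (hfa b)) (Set.toFinite _),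
    Set.ncard_union_eq ?_ (hfa a) (hfa b), h1, h1, Set.ncard_image_of_injective _ hf]
  · rw [Set.disjoint_left]
    rintro g ⟨rfl, -⟩ ⟨h, -⟩
    exact hab h
  · rw [Set.disjoint_left]
    rintro g (⟨rfl, -⟩ | ⟨rfl, -⟩) ⟨i, -, h⟩
    · exact ha i h.symm
    · exact hb i h.symm

open Classical in
/-- The indicator function of a set of edges on the outer 5-cycle. -/
noncomputable def outerCount (A : Set (MeredithEdge s)) (i : ZMod 5) : ℕ :=
  if outerEdge s i ∈ A then 1 else 0

open Classical in
/-- The indicator function of a set of edges on the inner 5-cycle. -/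
noncomputable def innerCount (A : Set (MeredithEdge s)) (i : ZMod 5) : ℕ :=
  if innerEdge s i ∈ A then 1 else 0

/-- The number of parallel copies of a spoke in a set of edges. -/
noncomputable def spokeCount (A : Set (MeredithEdge s)) (i : ZMod 5) : ℕ :=
  {c | spokeEdge s i c ∈ A}.ncard

theorem ncard_inc_false (A : Set (MeredithEdge s)) (i : ZMod 5) :
    {g | (meredith s).Inc g (false, i) ∧ g ∈ A}.ncard =
      outerCount A i + outerCount A (i - 1) + spokeCount A i := by
  simp only [meredith_inc_false]
  refine ncard_eq_or_eq_or_exists ?_ (spokeEdge_injective s i)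
    (outerEdge_ne_spokeEdge _ _) (outerEdge_ne_spokeEdge _ _) A
  intro h
  exact absurd (sub_eq_self.1 (outerEdge_injective s h).symm) (by decide)

theorem ncard_inc_true (A : Set (MeredithEdge s)) (i : ZMod 5) :
    {g | (meredith s).Inc g (true, i) ∧ g ∈ A}.ncard =
      innerCount A i + innerCount A (i - 2) + spokeCount A i := by
  simp only [meredith_inc_true]
  refine ncard_eq_or_eq_or_exists ?_ (spokeEdge_injective s i)
    (innerEdge_ne_spokeEdge _ _) (innerEdge_ne_spokeEdge _ _) A
  intro h
  exact absurd (sub_eq_self.1 (innerEdge_injective s h).symm) (by decide)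

theorem isRegular_meredith (hs : 3 ≤ s) : (meredith s).IsRegular s := by
  rintro ⟨_ | _, i⟩ -
  · have := ncard_inc_false (s := s) Set.univ i
    simp only [Set.mem_univ, and_true] at this
    rw [degree, incidenceSet, this]
    simp [outerCount, spokeCount, Set.ncard_univ, Nat.card_eq_fintype_card]
    omega
  · have := ncard_inc_true (s := s) Set.univ i
    simp only [Set.mem_univ, and_true] at this
    rw [degree, incidenceSet, this]
    simp [innerCount, spokeCount, Set.ncard_univ, Nat.card_eq_fintype_card]
    omega

theorem isSimpleEdge_outerEdge :
    (meredith s).IsSimpleEdge (outerEdge s 0) (false, 0) (false, 1) := by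
  refine ⟨meredith_isLink_outerEdge 0, ?_⟩
  rintro (p | ⟨p, c⟩) h
  · rw [h.1]; rfl
  · exact absurd rfl h.2.1

instance loopless_meredith : (meredith s).Loopless := by
  refine ⟨?_⟩
  rintro (p | ⟨p, c⟩) x h
  · exact h.2.ne rfl
  · exact h.2.1 rfl

/-- The outer cycle remains a path 1, 2, 3, 4, 0, and every inner vertex hangs on it by a spoke. -/
theorem connected_deleteEdges_meredith :
    ((meredith s).deleteEdges {outerEdge s 0}).Connected := by
  set H := (meredith s).deleteEdges {outerEdge s 0}
  have h1 : ∀ i ≠ 0, H.Adj (false, i) (false, i + 1) := fun i hi =>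
    ⟨_, meredith_isLink_outerEdge i, fun h => hi (outerEdge_injective s h)⟩
  have h2 : ∀ i, H.Adj (false, i) (true, i) := fun i =>
    ⟨_, meredith_isLink_spokeEdge i none, fun h => outerEdge_ne_spokeEdge _ _ _ h.symm⟩
  have h3 : ∀ i, Relation.ReflTransGen H.Adj (false, 1) (false, i) := by
    have a2 : Relation.ReflTransGen H.Adj (false, 1) (false, 2) := .single (h1 1 (by decide))
    have a3 : Relation.ReflTransGen H.Adj (false, 1) (false, 3) := a2.tail (h1 2 (by decide))
    have a4 : Relation.ReflTransGen H.Adj (false, 1) (false, 4) := a3.tail (h1 3 (by decide))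
    have a0 : Relation.ReflTransGen H.Adj (false, 1) (false, 0) := a4.tail (h1 4 (by decide))
    exact forall_zmod_five.2 ⟨a0, .refl, a2, a3, a4⟩
  have h4 : ∀ x, Relation.ReflTransGen H.Adj (false, 1) x := by
    rintro ⟨_ | _, i⟩
    · exact h3 i
    · exact (h3 i).tail (h2 i)
  exact ⟨⟨(false, 1), Set.mem_univ _⟩, fun x _ y _ => (reflTransGen_adj_symm (h4 x)).trans (h4 y)⟩

end meredith

/-! ### Odd cuts of the Meredith graph -/

/-- The bits record which outer and inner vertices lie in an odd set; the three groups of summands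
count the outer edges, inner edges and spokes that are cut. All 1024 cases are checked. -/
theorem petersen_cut : ∀ a0 a1 a2 a3 a4 b0 b1 b2 b3 b4 : Bool,
    (a0.toNat + a1.toNat + a2.toNat + a3.toNat + a4.toNat +
      (b0.toNat + b1.toNat + b2.toNat + b3.toNat + b4.toNat)) % 2 = 1 →
    3 ≤ (a0 ^^ a1).toNat + (a1 ^^ a2).toNat + (a2 ^^ a3).toNat + (a3 ^^ a4).toNat +
        (a4 ^^ a0).toNat +
      ((b0 ^^ b2).toNat + (b1 ^^ b3).toNat + (b2 ^^ b4).toNat + (b3 ^^ b0).toNat +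
        (b4 ^^ b1).toNat) +
      ((a0 ^^ b0).toNat + (a1 ^^ b1).toNat + (a2 ^^ b2).toNat + (a3 ^^ b3).toNat +
        (a4 ^^ b4).toNat) := by
  decide +kernel

/-- The edges of the Petersen graph: outer edges, inner edges and spokes. -/
def petersenEdge (s : ℕ) : Fin 3 × ZMod 5 → MeredithEdge s
  | (0, i) => outerEdge s i
  | (1, i) => innerEdge s i
  | (2, i) => spokeEdge s i none

/-- The ends of the edges of the Petersen graph. -/
def petersenEnds : Fin 3 × ZMod 5 → (Bool × ZMod 5) × (Bool × ZMod 5)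
  | (0, i) => ((false, i), (false, i + 1))
  | (1, i) => ((true, i), (true, i + 2))
  | (2, i) => ((false, i), (true, i))

section meredith

variable {s : ℕ}

theorem petersenEdge_injective (s : ℕ) : Function.Injective (petersenEdge s) := by
  rintro ⟨a, i⟩ ⟨b, j⟩ h
  fin_cases a <;> fin_cases b <;> simp only [petersenEdge] at h
  · rw [outerEdge_injective s h]
  · exact absurd h (outerEdge_ne_innerEdge _ _)
  · exact absurd h (outerEdge_ne_spokeEdge _ _ _)
  · exact absurd h.symm (outerEdge_ne_innerEdge _ _)
  · rw [innerEdge_injective s h]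
  · exact absurd h (innerEdge_ne_spokeEdge _ _ _)
  · exact absurd h.symm (outerEdge_ne_spokeEdge _ _ _)
  · exact absurd h.symm (innerEdge_ne_spokeEdge _ _ _)
  · rw [(spokeEdge_inj.1 h).1]

theorem meredith_isLink_petersenEdge (k : Fin 3 × ZMod 5) :
    (meredith s).IsLink (petersenEdge s k) (petersenEnds k).1 (petersenEnds k).2 := by
  obtain ⟨a, i⟩ := k
  fin_cases a
  · exact meredith_isLink_outerEdge i
  · exact meredith_isLink_innerEdge i
  · exact meredith_isLink_spokeEdge i none

/-- The Petersen graph contributes three cut edges. An odd set is not a union of pairs of spoke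
ends, so it separates the ends of some spoke, whose `s - 3` additional copies are then cut as well.
-/
theorem isSGraph_meredith (hs : 3 ≤ s) : (meredith s).IsSGraph s := by
  classical
  refine ⟨Set.toFinite _, Set.toFinite _, loopless_meredith, isRegular_meredith hs, ?_⟩
  rintro X - hodd
  set b : Bool × ZMod 5 → Bool := fun x => decide (x ∈ X) with hb
  have hmem : ∀ {g x y}, (meredith s).IsLink g x y → (b x ^^ b y) = true →
      g ∈ (meredith s).edgeBoundary X := by
    intro g x y hxy h
    by_cases hx : x ∈ X
    · exact ⟨x, hx, y, ⟨Set.mem_univ _, by simpa [hb, hx] using h⟩, hxy⟩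
    · exact ⟨y, by simpa [hb, hx] using h, x, ⟨Set.mem_univ _, hx⟩, hxy.symm⟩
  have hcount : ∀ {ι : Type} [Fintype ι] (p : ι → Bool),
      {k | p k = true}.ncard = ∑ k, (p k).toNat := by
    intro ι _ p
    rw [Set.ncard_eq_toFinset_card', Set.toFinset_ofPred, Finset.card_filter]
    refine Finset.sum_congr rfl fun k _ => ?_
    cases p k <;> rfl
  have hX : X.ncard = ∑ x, (b x).toNat := by
    rw [← hcount]
    congr 1
    ext x
    simp [hb]
  rw [hX, Fintype.sum_prod_type, Fintype.sum_bool, sum_zmod_five, sum_zmod_five,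
    add_comm, Nat.odd_iff] at hodd
  have h3 : 3 ≤ {k | (b (petersenEnds k).1 ^^ b (petersenEnds k).2) = true}.ncard := by
    rw [hcount, Fintype.sum_prod_type, Fin.sum_univ_three, sum_zmod_five, sum_zmod_five,
      sum_zmod_five]
    exact petersen_cut _ _ _ _ _ _ _ _ _ _ hodd
  obtain ⟨i, hi⟩ : ∃ i, (b (false, i) ^^ b (true, i)) = true := by
    by_contra! hcon
    have : ∀ i, b (false, i) = b (true, i) := by simpa using hcon
    simp only [this] at hodd
    omega
  have hsub : petersenEdge s '' {k | (b (petersenEnds k).1 ^^ b (petersenEnds k).2) = true} ∪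
      Set.range (fun c : Fin (s - 3) => spokeEdge s i (some c)) ⊆
        (meredith s).edgeBoundary X := by
    rintro _ (⟨k, hk, rfl⟩ | ⟨c, rfl⟩)
    · exact hmem (meredith_isLink_petersenEdge k) hk
    · exact hmem (meredith_isLink_spokeEdge i (some c)) hi
  have hle := Set.ncard_le_ncard hsub (Set.toFinite _)
  rw [Set.ncard_union_eq, Set.ncard_image_of_injective _ (petersenEdge_injective s),
    Set.ncard_range_of_injective, Nat.card_eq_fintype_card, Fintype.card_fin] at hle
  · omega
  · exact fun c d h => by simpa using spokeEdge_injective s i h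
  · rw [Set.disjoint_left]
    rintro _ ⟨⟨a, j⟩, -, rfl⟩ ⟨c, h⟩
    fin_cases a <;> simp only [petersenEdge] at h
    · exact outerEdge_ne_spokeEdge _ _ _ h.symm
    · exact innerEdge_ne_spokeEdge _ _ _ h.symm
    · simpa using (spokeEdge_inj.1 h).2

/-! ### Parity of factors on the outer 5-cycle -/

/-- In a subgraph of the Meredith graph in which all vertices have the same degree `d`, except that
the degrees of the ends of the edge `outerEdge s 0` are `d - a` and `d - b`, the numbers `a` and `b`
have the same parity. -/
theorem meredith_parity {A : Set (MeredithEdge s)} {a b d : ℕ}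
    (h0 : {g | (meredith s).Inc g (false, 0) ∧ g ∈ A}.ncard + a = d)
    (h1 : {g | (meredith s).Inc g (false, 1) ∧ g ∈ A}.ncard + b = d)
    (h : ∀ x ≠ (false, 0), x ≠ (false, 1) → {g | (meredith s).Inc g x ∧ g ∈ A}.ncard = d) :
    a % 2 = b % 2 := by
  have f2 := h (false, 2) (by decide) (by decide)
  have f3 := h (false, 3) (by decide) (by decide)
  have f4 := h (false, 4) (by decide) (by decide)
  have t := fun i => h (true, i) (by simp) (by simp)
  simp only [ncard_inc_false, ncard_inc_true, forall_zmod_five] at h0 h1 f2 f3 f4 t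
  simp only [show (0 - 1 : ZMod 5) = 4 from rfl, show (1 - 1 : ZMod 5) = 0 from rfl,
    show (2 - 1 : ZMod 5) = 1 from rfl, show (3 - 1 : ZMod 5) = 2 from rfl,
    show (4 - 1 : ZMod 5) = 3 from rfl, show (0 - 2 : ZMod 5) = 3 from rfl,
    show (1 - 2 : ZMod 5) = 4 from rfl, show (2 - 2 : ZMod 5) = 0 from rfl,
    show (3 - 2 : ZMod 5) = 1 from rfl, show (4 - 2 : ZMod 5) = 2 from rfl] at h0 h1 f2 f3 f4 t
  -- In the sum of the ten degree equations every edge count occurs twice, so `10 * d - a - b` is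
  -- even.
  omega

/-- A single one, or three cyclically consecutive ones, among the `o`'s would force a negative `n`.
What remains is 11111 and the rotations of 11010. -/
theorem petersen_two_factor_aux {o0 o1 o2 o3 o4 n0 n1 n2 n3 n4 : ℕ}
    (h0 : o0 ≤ 1) (h1 : o1 ≤ 1) (h2 : o2 ≤ 1) (h3 : o3 ≤ 1) (h4 : o4 ≤ 1)
    (e0 : n0 + o3 = o0 + o1) (e1 : n1 + o4 = o1 + o2) (e2 : n2 + o0 = o2 + o3)
    (e3 : n3 + o1 = o3 + o4) (e4 : n4 + o2 = o4 + o0)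
    (hodd : (o0 + o1 + o2 + o3 + o4) % 2 = 1) :
    (o0 = 1 ∧ o1 = 1 ∧ o2 = 1 ∧ o3 = 1 ∧ o4 = 1) ∨
      (o0 = 1 ∧ o1 = 1 ∧ o2 = 0 ∧ o3 = 1 ∧ o4 = 0) ∨
      (o1 = 1 ∧ o2 = 1 ∧ o3 = 0 ∧ o4 = 1 ∧ o0 = 0) ∨
      (o2 = 1 ∧ o3 = 1 ∧ o4 = 0 ∧ o0 = 1 ∧ o1 = 0) ∨
      (o3 = 1 ∧ o4 = 1 ∧ o0 = 0 ∧ o1 = 1 ∧ o2 = 0) ∨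
      (o4 = 1 ∧ o0 = 1 ∧ o1 = 0 ∧ o2 = 1 ∧ o3 = 0) := by
  interval_cases o0 <;> interval_cases o1 <;> interval_cases o2 <;> interval_cases o3 <;>
    interval_cases o4 <;> first | (exfalso; omega) | simp

/-- The two ends of a spoke share its count, so n_i + n_{i-2} = o_i + o_{i-1}. These equations run
around a cycle of odd length and hence determine all n_i. -/
theorem petersen_eq_of_add_eq {o0 o1 o2 o3 o4 n0 n1 n2 n3 n4 t0 t1 t2 t3 t4 d : ℕ}
    (a0 : o0 + o4 + t0 = d) (a1 : o1 + o0 + t1 = d) (a2 : o2 + o1 + t2 = d)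
    (a3 : o3 + o2 + t3 = d) (a4 : o4 + o3 + t4 = d) (b0 : n0 + n3 + t0 = d)
    (b1 : n1 + n4 + t1 = d) (b2 : n2 + n0 + t2 = d) (b3 : n3 + n1 + t3 = d)
    (b4 : n4 + n2 + t4 = d) :
    n0 + o3 = o0 + o1 ∧ n1 + o4 = o1 + o2 ∧ n2 + o0 = o2 + o3 ∧ n3 + o1 = o3 + o4 ∧
      n4 + o2 = o4 + o0 := by
  refine ⟨?_, ?_, ?_, ?_, ?_⟩ <;> omega

/-- Every odd pattern has two consecutive ones, that is, two outer edges at one vertex, which is too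
many for a 1-factor. -/
theorem even_of_forall_eq_one {o n t : ZMod 5 → ℕ} (h1 : ∀ i, o i + o (i - 1) + t i = 1)
    (h2 : ∀ i, n i + n (i - 2) + t i = 1) : Even (∑ i, o i) := by
  have e := petersen_eq_of_add_eq (h1 0) (h1 1) (h1 2) (h1 3) (h1 4) (h2 0) (h2 1) (h2 2) (h2 3)
    (h2 4)
  have ho : ∀ i, o i ≤ 1 := fun i => by have := h1 i; omega
  by_contra hodd
  rw [sum_zmod_five, Nat.not_even_iff] at hodd
  have h5 : ∀ {i j}, o i = 1 → o j = 1 → o i + o j + t i = 1 → False := by omega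
  rcases petersen_two_factor_aux (ho 0) (ho 1) (ho 2) (ho 3) (ho 4) e.1 e.2.1 e.2.2.1 e.2.2.2.1
    e.2.2.2.2 hodd with h | h | h | h | h | h
  · exact h5 h.2.1 h.1 (h1 1)
  · exact h5 h.2.1 h.1 (h1 1)
  · exact h5 h.2.1 h.1 (h1 2)
  · exact h5 h.2.1 h.1 (h1 3)
  · exact h5 h.2.1 h.1 (h1 4)
  · exact h5 h.2.1 h.1 (h1 0)

/-- The two groups of the conclusion list the edges of two disjoint 5-cycles: one with two outer
edges and one inner edge, the other with one outer edge and two inner edges. -/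
theorem petersen_eq_one_of_pattern {o0 o1 o2 o3 o4 n0 n1 n2 n3 n4 t0 t1 t2 t3 t4 : ℕ}
    (a0 : o0 + o4 + t0 = 2) (a1 : o1 + o0 + t1 = 2) (a2 : o2 + o1 + t2 = 2)
    (a3 : o3 + o2 + t3 = 2) (a4 : o4 + o3 + t4 = 2)
    (e : n0 + o3 = o0 + o1 ∧ n1 + o4 = o1 + o2 ∧ n2 + o0 = o2 + o3 ∧ n3 + o1 = o3 + o4 ∧
      n4 + o2 = o4 + o0)
    (h : o0 = 1 ∧ o1 = 1 ∧ o2 = 0 ∧ o3 = 1 ∧ o4 = 0) :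
    (o0 = 1 ∧ o1 = 1 ∧ t2 = 1 ∧ n0 = 1 ∧ t0 = 1) ∧
      (o3 = 1 ∧ t4 = 1 ∧ n4 = 1 ∧ n1 = 1 ∧ t3 = 1) := by
  obtain ⟨rfl, rfl, rfl, rfl, rfl⟩ := h
  refine ⟨⟨rfl, rfl, ?_, ?_, ?_⟩, rfl, ?_, ?_, ?_, ?_⟩ <;> omega

theorem exists_of_forall_eq_two {o n t : ZMod 5 → ℕ} (ho : ∀ i, o i ≤ 1)
    (h1 : ∀ i, o i + o (i - 1) + t i = 2) (h2 : ∀ i, n i + n (i - 2) + t i = 2)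
    (hodd : Odd (∑ i, o i)) :
    (∀ i, n i = 1) ∨ ∃ a, (o a = 1 ∧ o (a + 1) = 1 ∧ t (a + 2) = 1 ∧ n a = 1 ∧ t a = 1) ∧
      (o (a + 3) = 1 ∧ t (a + 4) = 1 ∧ n (a + 4) = 1 ∧ n (a + 1) = 1 ∧ t (a + 3) = 1) := by
  rw [sum_zmod_five, Nat.odd_iff] at hodd
  obtain ⟨e0, e1, e2, e3, e4⟩ := petersen_eq_of_add_eq (h1 0) (h1 1) (h1 2) (h1 3) (h1 4) (h2 0)
    (h2 1) (h2 2) (h2 3) (h2 4)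
  rcases petersen_two_factor_aux (ho 0) (ho 1) (ho 2) (ho 3) (ho 4) e0 e1 e2 e3 e4 hodd with
    ⟨c0, c1, c2, c3, c4⟩ | h | h | h | h | h
  · have h5 : ∀ {p q r u : ℕ}, p + q = r + u → q = 1 → r = 1 → u = 1 → p = 1 := by omega
    exact Or.inl (forall_zmod_five.2 ⟨h5 e0 c3 c0 c1, h5 e1 c4 c1 c2, h5 e2 c0 c2 c3,
      h5 e3 c1 c3 c4, h5 e4 c2 c4 c0⟩)
  · exact Or.inr ⟨0, petersen_eq_one_of_pattern (h1 0) (h1 1) (h1 2) (h1 3) (h1 4)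
      ⟨e0, e1, e2, e3, e4⟩ h⟩
  · exact Or.inr ⟨1, petersen_eq_one_of_pattern (h1 1) (h1 2) (h1 3) (h1 4) (h1 0)
      ⟨e1, e2, e3, e4, e0⟩ h⟩
  · exact Or.inr ⟨2, petersen_eq_one_of_pattern (h1 2) (h1 3) (h1 4) (h1 0) (h1 1)
      ⟨e2, e3, e4, e0, e1⟩ h⟩
  · exact Or.inr ⟨3, petersen_eq_one_of_pattern (h1 3) (h1 4) (h1 0) (h1 1) (h1 2)
      ⟨e3, e4, e0, e1, e2⟩ h⟩
  · exact Or.inr ⟨4, petersen_eq_one_of_pattern (h1 4) (h1 0) (h1 1) (h1 2) (h1 3)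
      ⟨e4, e0, e1, e2, e3⟩ h⟩

theorem even_sum_outerCount {A : Set (MeredithEdge s)}
    (hA : ∀ x, {g | (meredith s).Inc g x ∧ g ∈ A}.ncard = 1) : Even (∑ i, outerCount A i) :=
  even_of_forall_eq_one (fun i => (ncard_inc_false A i).symm.trans (hA _))
    (fun i => (ncard_inc_true A i).symm.trans (hA _))

theorem exists_spokeEdge_mem {A : Set (MeredithEdge s)} {i : ZMod 5} (h : spokeCount A i = 1) :
    ∃ c, spokeEdge s i c ∈ A := by
  obtain ⟨c, hc⟩ := Set.ncard_eq_one.1 h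
  exact ⟨c, (Set.ext_iff.1 hc c).2 rfl⟩

theorem outerEdge_mem {A : Set (MeredithEdge s)} {i : ZMod 5} (h : outerCount A i = 1) :
    outerEdge s i ∈ A := by
  by_contra h1
  simp [outerCount, h1] at h

theorem innerEdge_mem {A : Set (MeredithEdge s)} {i : ZMod 5} (h : innerCount A i = 1) :
    innerEdge s i ∈ A := by
  by_contra h1
  simp [innerCount, h1] at h

/-- A 2-factor of the Meredith graph with an odd number of edges on the outer 5-cycle contains a
5-cycle which avoids the edge `outerEdge s 0`. -/
theorem exists_five_cycle {A : Set (MeredithEdge s)}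
    (hA : ∀ x, {g | (meredith s).Inc g x ∧ g ∈ A}.ncard = 2) (hodd : Odd (∑ i, outerCount A i)) :
    ∃ (y : ZMod 5 → Bool × ZMod 5) (g : ZMod 5 → MeredithEdge s), Function.Injective y ∧
      ∀ i, g i ∈ A ∧ g i ≠ outerEdge s 0 ∧ (meredith s).IsLink (g i) (y i) (y (i + 1)) := by
  have hne : ∀ i ≠ 0, outerEdge s i ≠ outerEdge s 0 := fun i hi h => hi (outerEdge_injective s h)
  have hne' : ∀ i c, spokeEdge s i c ≠ outerEdge s 0 := fun i c =>
    (outerEdge_ne_spokeEdge _ _ _).symm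
  have hni : ∀ i, innerEdge s i ≠ outerEdge s 0 := fun i => (outerEdge_ne_innerEdge _ _).symm
  rcases exists_of_forall_eq_two (o := outerCount A) (n := innerCount A) (t := spokeCount A)
    (fun i => by unfold outerCount; split_ifs <;> simp)
    (fun i => (ncard_inc_false A i).symm.trans (hA _))
    (fun i => (ncard_inc_true A i).symm.trans (hA _)) hodd with
    h | ⟨a, ⟨h1, h2, h3, h4, h5⟩, h6, h7, h8, h9, h10⟩
  -- The inner pentagram is traversed in steps of 2.
  · refine ⟨fun i => (true, 2 * i), fun i => innerEdge s (2 * i), ?_, fun i =>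
      ⟨innerEdge_mem (h _), hni _, ?_⟩⟩
    · unfold Function.Injective
      decide
    · have := meredith_isLink_innerEdge (s := s) (2 * i)
      rwa [show 2 * i + 2 = 2 * (i + 1) by ring] at this
  · obtain ⟨c, hc⟩ := exists_spokeEdge_mem h3
    obtain ⟨c', hc'⟩ := exists_spokeEdge_mem h5
    obtain ⟨d, hd⟩ := exists_spokeEdge_mem h7
    obtain ⟨d', hd'⟩ := exists_spokeEdge_mem h10
    -- The first 5-cycle has the outer edges `a` and `a + 1`, the second only `a + 3`. If the first
    -- one contains `outerEdge s 0`, then `a` is 0 or 4, and the second avoids it.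
    by_cases ha : a ≠ 0 ∧ a + 1 ≠ 0
    · refine ⟨![(false, a), (false, a + 1), (false, a + 2), (true, a + 2), (true, a)],
        ![outerEdge s a, outerEdge s (a + 1), spokeEdge s (a + 2) c, innerEdge s a,
          spokeEdge s a c'], ?_, ?_⟩
      · have key : ∀ (a : ZMod 5) (i j : Fin 5),
            (![(false, a), (false, a + 1), (false, a + 2), (true, a + 2), (true, a)] :
              Fin 5 → Bool × ZMod 5) i =
            (![(false, a), (false, a + 1), (false, a + 2), (true, a + 2), (true, a)] :
              Fin 5 → Bool × ZMod 5) j → i = j := by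
          decide +kernel
        exact key a
      · rw [forall_zmod_five]
        refine ⟨⟨outerEdge_mem h1, hne _ ha.1, meredith_isLink_outerEdge _⟩,
          ⟨outerEdge_mem h2, hne _ ha.2, ?_⟩, ⟨hc, hne' _ _, meredith_isLink_spokeEdge _ _⟩,
          ⟨innerEdge_mem h4, hni _, (meredith_isLink_innerEdge _).symm⟩,
          ⟨hc', hne' _ _, (meredith_isLink_spokeEdge _ _).symm⟩⟩
        have := meredith_isLink_outerEdge (s := s) (a + 1)
        rw [add_assoc] at this
        exact this
    · refine ⟨![(false, a + 3), (false, a + 4), (true, a + 4), (true, a + 1), (true, a + 3)],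
        ![outerEdge s (a + 3), spokeEdge s (a + 4) d, innerEdge s (a + 4), innerEdge s (a + 1),
          spokeEdge s (a + 3) d'], ?_, ?_⟩
      · have key : ∀ (a : ZMod 5) (i j : Fin 5),
            (![(false, a + 3), (false, a + 4), (true, a + 4), (true, a + 1), (true, a + 3)] :
              Fin 5 → Bool × ZMod 5) i =
            (![(false, a + 3), (false, a + 4), (true, a + 4), (true, a + 1), (true, a + 3)] :
              Fin 5 → Bool × ZMod 5) j → i = j := by
          decide +kernel
        exact key a
      · have ha3 : a + 3 ≠ 0 := by
          clear * - ha
          revert a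
          decide
        rw [forall_zmod_five]
        refine ⟨⟨outerEdge_mem h6, hne _ ha3, ?_⟩, ⟨hd, hne' _ _, meredith_isLink_spokeEdge _ _⟩,
          ⟨innerEdge_mem h8, hni _, ?_⟩, ⟨innerEdge_mem h9, hni _, ?_⟩,
          ⟨hd', hne' _ _, (meredith_isLink_spokeEdge _ _).symm⟩⟩
        · have := meredith_isLink_outerEdge (s := s) (a + 3)
          rw [add_assoc] at this
          exact this
        · have := meredith_isLink_innerEdge (s := s) (a + 4)
          rw [add_assoc] at this
          exact this
        · have := meredith_isLink_innerEdge (s := s) (a + 1)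
          rw [add_assoc] at this
          exact this

/-- Each of the five outer edges is counted once. That 5 is odd is the source of both lower bounds.
-/
theorem sum_sum_outerCount {ι : Type*} [Fintype ι] (A : ι → Set (MeredithEdge s))
    (hA : ∀ i, ∃! j, outerEdge s i ∈ A j) : ∑ j, ∑ i, outerCount (A j) i = 5 := by
  classical
  rw [Finset.sum_comm, sum_zmod_five]
  have : ∀ i, ∑ j, outerCount (A j) i = 1 := by
    intro i
    obtain ⟨j, hj, huniq⟩ := hA i
    rw [Finset.sum_eq_single j]
    · simp [outerCount, hj]
    · intro j' _ hne
      simp only [outerCount, ite_eq_right_iff, one_ne_zero, imp_false]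
      exact fun h => hne (huniq j' h)
    · simp
  simp [this]

end meredith

/-! ### Colorings and decompositions restricted to one copy -/

theorem sum_ncard_of_existsUnique {ι β : Type*} [Fintype ι] [Finite β] {S : Set β} {A : ι → Set β}
    (hA : ∀ g ∈ S, ∃! j, g ∈ A j) : ∑ j, {g | g ∈ S ∧ g ∈ A j}.ncard = S.ncard := by
  classical
  have := Fintype.ofFinite β
  have h1 := Finset.sum_card_bipartiteAbove_eq_sum_card_bipartiteBelow
    (fun (j : ι) (g : β) => g ∈ A j) (s := Finset.univ) (t := S.toFinset)
  have h2 : ∀ g ∈ S.toFinset,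
      (Finset.bipartiteBelow (fun (j : ι) (g : β) => g ∈ A j) Finset.univ g).card = 1 := by
    intro g hg
    obtain ⟨j, hj, huniq⟩ := hA g (Set.mem_toFinset.1 hg)
    refine Finset.card_eq_one.2 ⟨j, ?_⟩
    ext j'
    simp only [Finset.bipartiteBelow, Finset.mem_filter, Finset.mem_univ, true_and,
      Finset.mem_singleton]
    exact ⟨huniq j', fun h => h ▸ hj⟩
  rw [Finset.sum_congr rfl h2, Finset.sum_const, smul_eq_mul, mul_one,
    ← Set.ncard_eq_toFinset_card'] at h1
  rw [← h1]
  refine Finset.sum_congr rfl fun j _ => ?_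
  rw [← Set.ncard_coe_finset]
  congr 1
  ext g
  simp [Finset.bipartiteAbove]

/-- The graph obtained by gluing `m` copies of `meredith s - outerEdge s 0` cyclically. -/
noncomputable abbrev meredithRing (s m : ℕ) [NeZero m] :
    Graph (Fin m × (Bool × ZMod 5)) ((Fin m × MeredithEdge s) ⊕ Fin m) :=
  ring m (isSimpleEdge_outerEdge (s := s)).1

section lower

variable {s m : ℕ} [NeZero m]

theorem meredith_inc_outerEdge_zero {x : Bool × ZMod 5} :
    (meredith s).Inc (outerEdge s 0) x ↔ x = (false, 0) ∨ x = (false, 1) := by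
  refine ⟨fun h => h.eq_or_eq_of_isLink (meredith_isLink_outerEdge 0), ?_⟩
  rintro (rfl | rfl)
  · exact (meredith_isLink_outerEdge 0).inc_left
  · exact (meredith_isLink_outerEdge 0).inc_right

/-- If after the deletion of some edges the graph `meredithRing s m` can be edge-colored with `s`
colors, then an edge has been deleted from every copy of the Meredith graph. -/
theorem exists_mem_of_edgeColorable (hs : 3 ≤ s) {F : Set ((Fin m × MeredithEdge s) ⊕ Fin m)}
    (hc : ((meredithRing s m).deleteEdges F).EdgeColorable s) (i : Fin m) :
    ∃ g, .inl (i, g) ∈ F := by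
  classical
  by_contra! hF
  set H := (meredithRing s m).deleteEdges F
  obtain ⟨c, hc⟩ := hc
  have hmem : ∀ {g}, g ∈ E(meredith s) → g ≠ outerEdge s 0 → Sum.inl (i, g) ∈ E(H) :=
    fun hg hne => ⟨(inl_mem_edgeSet_ring _).2 ⟨hg, hne⟩, hF _⟩
  have hmem' : ∀ {g}, Sum.inl (i, g) ∈ E(H) → g ∈ E(meredith s) ∧ g ≠ outerEdge s 0 :=
    fun hg => (inl_mem_edgeSet_ring _).1 hg.1
  set A : Fin s → Set (MeredithEdge s) := fun j => {g | ∃ h : .inl (i, g) ∈ E(H), c ⟨_, h⟩ = j}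
    with hA
  have huniq : ∀ {g}, g ∈ E(meredith s) → g ≠ outerEdge s 0 → ∃! j, g ∈ A j := fun hg hne =>
    ⟨c ⟨_, hmem hg hne⟩, ⟨hmem hg hne, rfl⟩, fun j ⟨_, h⟩ => h.symm⟩
  have heA : ∀ j, outerEdge s 0 ∉ A j := fun j ⟨h, _⟩ => (hmem' h).2 rfl
  set D : Fin s → Bool × ZMod 5 → ℕ := fun j x => {g | (meredith s).Inc g x ∧ g ∈ A j}.ncard
    with hD
  have hle : ∀ j x, D j x ≤ 1 := by
    intro j x
    refine (Set.ncard_le_one_iff (Set.toFinite _)).2 ?_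
    rintro g g' ⟨⟨y, hy⟩, h, hg⟩ ⟨⟨y', hy'⟩, h', hg'⟩
    by_contra hne
    refine hc ⟨_, h⟩ ⟨_, h'⟩ (i, x) (by simpa using hne)
      ⟨(i, y), (ring_isLink_inl_mk _).2 ⟨hy, (hmem' h).2⟩, hF _⟩
      ⟨(i, y'), (ring_isLink_inl_mk _).2 ⟨hy', (hmem' h').2⟩, hF _⟩ (hg.trans hg'.symm)
  have hsum : ∀ x, ∑ j, D j x = ((meredith s).incidenceSet x \ {outerEdge s 0}).ncard := by
    intro x
    rw [← sum_ncard_of_existsUnique (S := (meredith s).incidenceSet x \ {outerEdge s 0}) (A := A)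
      fun g hg => huniq hg.1.edge_mem hg.2]
    refine Finset.sum_congr rfl fun j _ => congrArg Set.ncard (Set.ext fun g => ?_)
    constructor
    · rintro ⟨h1, h2⟩
      exact ⟨⟨h1, fun h => heA j (h ▸ h2)⟩, h2⟩
    · rintro ⟨⟨h1, -⟩, h2⟩
      exact ⟨h1, h2⟩
  have hdeg : ∀ x, ((meredith s).incidenceSet x).ncard = s :=
    fun x => isRegular_meredith hs x (Set.mem_univ _)
  have hone : ∀ j x, x ≠ (false, 0) → x ≠ (false, 1) → D j x = 1 := by
    intro j x h0 h1
    have h2 := hsum x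
    have h3 : outerEdge s 0 ∉ (meredith s).incidenceSet x :=
      fun h => (meredith_inc_outerEdge_zero.1 h).elim h0 h1
    rw [Set.sdiff_singleton_eq_self h3, hdeg] at h2
    have h4 : ∑ j, D j x = ∑ _j : Fin s, 1 := by simpa using h2
    exact (Finset.sum_eq_sum_iff_of_le fun j _ => hle j x).1 h4 j (Finset.mem_univ _)
  -- By handshaking, a color missing at one end of `outerEdge s 0` is missing at the other end too.
  have hpar : ∀ j, D j (false, 0) = D j (false, 1) := by
    intro j
    have h2 := meredith_parity (A := A j) (a := 1 - D j (false, 0)) (b := 1 - D j (false, 1))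
      (d := 1) (Nat.add_sub_of_le (hle j _)) (Nat.add_sub_of_le (hle j _)) (hone j)
    have h3 := hle j (false, 0)
    have h4 := hle j (false, 1)
    omega
  -- Without `outerEdge s 0`, the vertex has `s - 1` edges of distinct colors, so exactly one color
  -- is missing.
  have hzero : ∃! j, D j (false, 0) = 0 := by
    have h2 := hsum (false, 0)
    have he0 : outerEdge s 0 ∈ (meredith s).incidenceSet (false, 0) :=
      (meredith_isLink_outerEdge 0).inc_left
    rw [Set.ncard_sdiff_singleton_of_mem he0, hdeg] at h2
    have h3 : ∑ j, D j (false, 0) + (Finset.univ.filter fun j => D j (false, 0) = 0).card = s := by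
      rw [Finset.card_filter, ← Finset.sum_add_distrib, Finset.sum_congr rfl (g := fun _ => 1)]
      · simp
      · intro j _
        have := hle j (false, 0)
        split_ifs <;> omega
    obtain ⟨j, hj⟩ := Finset.card_eq_one.1
      (show (Finset.univ.filter fun j => D j (false, 0) = 0).card = 1 by omega)
    have h4 : ∀ j', D j' (false, 0) = 0 ↔ j' = j := fun j' => by
      simpa using Finset.ext_iff.1 hj j'
    exact ⟨j, (h4 j).2 rfl, fun j' h => (h4 j').1 h⟩
  -- Giving `outerEdge s 0` the missing color turns the color classes into 1-factors that partition
  -- the Meredith graph, contrary to parity.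
  set A' : Fin s → Set (MeredithEdge s) :=
    fun j => A j ∪ {g | g = outerEdge s 0 ∧ D j (false, 0) = 0} with hA'
  have hA'one : ∀ j x, {g | (meredith s).Inc g x ∧ g ∈ A' j}.ncard = 1 := by
    intro j x
    by_cases hj : D j (false, 0) = 0
    · by_cases hx : x = (false, 0) ∨ x = (false, 1)
      · have h0 : D j x = 0 := by
          rcases hx with rfl | rfl
          · exact hj
          · exact hpar j ▸ hj
        rw [hD] at h0
        have h1 := (Set.ncard_eq_zero (Set.toFinite _)).1 h0
        rw [Set.ncard_eq_one]
        refine ⟨outerEdge s 0, Set.ext fun g => ?_⟩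
        constructor
        · rintro ⟨hg, hg' | hg'⟩
          · exact absurd (show g ∈ {g | (meredith s).Inc g x ∧ g ∈ A j} from ⟨hg, hg'⟩)
              (h1 ▸ Set.notMem_empty g)
          · exact hg'.1
        · rintro rfl
          exact ⟨meredith_inc_outerEdge_zero.2 hx, Or.inr ⟨rfl, hj⟩⟩
      · rw [← hone j x (fun h => hx (Or.inl h)) (fun h => hx (Or.inr h))]
        refine congrArg Set.ncard (Set.ext fun g => ?_)
        constructor
        · rintro ⟨hg, hg' | hg'⟩
          · exact ⟨hg, hg'⟩
          · exact absurd (meredith_inc_outerEdge_zero.1 (hg'.1 ▸ hg)) hx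
        · rintro ⟨hg, hg'⟩
          exact ⟨hg, Or.inl hg'⟩
    · have h1 : A' j = A j := by simp [hA', hj]
      rw [h1]
      have h2 := hle j (false, 0)
      by_cases h3 : x = (false, 0)
      · subst h3
        change D j (false, 0) = 1
        omega
      · by_cases h4 : x = (false, 1)
        · subst h4
          change D j (false, 1) = 1
          have := hpar j
          omega
        · exact hone j x h3 h4
  have h5 := sum_sum_outerCount A' fun l => by
    by_cases hl : l = 0
    · subst hl
      obtain ⟨j, hj, hj'⟩ := hzero
      refine ⟨j, Or.inr ⟨rfl, hj⟩, ?_⟩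
      rintro j' (h | h)
      · exact absurd h (heA j')
      · exact hj' j' h.2
    · have hne : outerEdge s l ≠ outerEdge s 0 := fun h => hl (outerEdge_injective s h)
      obtain ⟨j, hj, hj'⟩ := huniq (meredith_isLink_outerEdge l).edge_mem hne
      refine ⟨j, Or.inl hj, ?_⟩
      rintro j' (h | h)
      · exact hj' j' h
      · exact absurd h.1 hne
  have h6 : Even (5 : ℕ) := h5 ▸ Finset.even_sum _ fun j _ => even_sum_outerCount (hA'one j)
  exact absurd h6 (by decide)

/-- In every decomposition of `meredithRing s m` into 1-factors and 2-factors, every copy of the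
Meredith graph contains a 5-cycle of one of the 2-factors. -/
theorem exists_five_cycle_of_decomposition {ι : Type*} [Fintype ι]
    {B : ι → Set ((Fin m × MeredithEdge s) ⊕ Fin m)} {d : ι → ℕ} (hd : ∀ j, d j = 1 ∨ d j = 2)
    (hreg : ∀ j p, {f | (meredithRing s m).Inc f p ∧ f ∈ B j}.ncard = d j)
    (hpart : ∀ f ∈ E(meredithRing s m), ∃! j, f ∈ B j) (i : Fin m) :
    ∃ j, d j = 2 ∧ ∃ (y : ZMod 5 → Bool × ZMod 5) (g : ZMod 5 → MeredithEdge s),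
      Function.Injective y ∧ ∀ l, .inl (i, g l) ∈ B j ∧
        (meredithRing s m).IsLink (.inl (i, g l)) (i, y l) (i, y (l + 1)) := by
  classical
  set e := outerEdge s 0 with he
  set ce : Bool × ZMod 5 → MeredithEdge s → (Fin m × MeredithEdge s) ⊕ Fin m :=
    copyEdge e (false, 0) (false, 1) i with hce
  have hinc : ∀ j x, {g | (meredith s).Inc g x ∧ ce x g ∈ B j}.ncard = d j := by
    intro j x
    rw [← hreg j (i, x)]
    exact (ncard_ring_inc isSimpleEdge_outerEdge.1 (by decide) (B j) i x).symm
  have hsplit : ∀ j x, (meredith s).Inc e x →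
      {g | (meredith s).Inc g x ∧ g ∈ {g | g ≠ e ∧ .inl (i, g) ∈ B j}}.ncard +
        (if ce x e ∈ B j then 1 else 0) = d j := by
    intro j x hx
    rw [← hinc j x]
    have h1 : {g | (meredith s).Inc g x ∧ g ∈ {g | g ≠ e ∧ .inl (i, g) ∈ B j}} =
        {g | (meredith s).Inc g x ∧ ce x g ∈ B j} \ {e} := by
      ext g
      by_cases hg : g = e
      · simp [hg]
      · simp [hg, hce, copyEdge_of_ne hg]
    rw [h1]
    split_ifs with h2
    · exact Set.ncard_sdiff_singleton_add_one ⟨hx, h2⟩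
    · rw [Set.sdiff_singleton_eq_self fun h => h2 h.2, add_zero]
  -- By handshaking, the connecting edges at the two ends of the copy lie in the same class.
  have hpar : ∀ j, ce (false, 0) e ∈ B j ↔ ce (false, 1) e ∈ B j := by
    intro j
    have h1 := meredith_parity (hsplit j _ (meredith_inc_outerEdge_zero.2 (Or.inl rfl)))
      (hsplit j _ (meredith_inc_outerEdge_zero.2 (Or.inr rfl))) (by
        intro x h0 h1
        rw [← hinc j x]
        refine congrArg Set.ncard (Set.ext fun g => ?_)
        refine and_congr_right fun hg => ?_
        have hne : g ≠ e := fun h => (meredith_inc_outerEdge_zero.1 (h ▸ hg)).elim h0 h1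
        simp [hne, hce, copyEdge_of_ne hne])
    split_ifs at h1 with h2 h3 h3 <;> simp_all
  -- The classes closed up inside the copy: the connecting edge at `(false, 0)` stands for `e`. By
  -- `hpar` the other end would give the same sets.
  set A : ι → Set (MeredithEdge s) := fun j => {g | ce (false, 0) g ∈ B j} with hA
  have hAd : ∀ j x, {g | (meredith s).Inc g x ∧ g ∈ A j}.ncard = d j := by
    intro j x
    rw [← hinc j x]
    refine congrArg Set.ncard (Set.ext fun g => ?_)
    refine and_congr_right fun hg => ?_
    by_cases hge : g = e
    · subst hge
      rcases meredith_inc_outerEdge_zero.1 hg with rfl | rfl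
      · rfl
      · exact hpar j
    · simp [hA, hce, copyEdge_of_ne hge]
  have h5 := sum_sum_outerCount A fun l => by
    refine hpart _ ?_
    by_cases hl : outerEdge s l = e
    · rw [hl, hce, copyEdge, if_pos rfl]
      exact inr_mem_edgeSet_ring _ _
    · rw [hce, copyEdge_of_ne hl]
      exact (inl_mem_edgeSet_ring _).2 ⟨(meredith_isLink_outerEdge l).edge_mem, hl⟩
  obtain ⟨j, hj⟩ : ∃ j, Odd (∑ l, outerCount (A j) l) := by
    by_contra! hcon
    have h6 : Even (5 : ℕ) := h5 ▸ Finset.even_sum _ fun j _ => Nat.not_odd_iff_even.1 (hcon j)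
    exact absurd h6 (by decide)
  have hj2 : d j = 2 := (hd j).resolve_left fun h =>
    Nat.not_even_iff_odd.2 hj (even_sum_outerCount fun x => (hAd j x).trans h)
  obtain ⟨y, g, hy, hg⟩ := exists_five_cycle (fun x => (hAd j x).trans hj2) hj
  refine ⟨j, hj2, y, g, hy, fun l => ?_⟩
  obtain ⟨h1, h2, h3⟩ := hg l
  refine ⟨?_, (ring_isLink_inl_mk _).2 ⟨h3, h2⟩⟩
  rwa [hA, Set.mem_ofPred_eq, hce, copyEdge_of_ne h2] at h1

end lower

/-! ### Lower bounds for oddness and resistance -/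

section bounds

variable {s m : ℕ} [NeZero m]

/-- Cycles lying in different copies are distinct, so there are at least `m` odd ones. Each 2-factor
spans an even number of vertices, so the total is even and cannot equal the odd number `m`. -/
theorem lt_sum_encard_oddCycles {n : ℕ} (hm : 2 ≤ m) (hodd : Odd m)
    {F : Fin n → Graph (Fin m × (Bool × ZMod 5)) ((Fin m × MeredithEdge s) ⊕ Fin m)}
    (hF : ∀ j, (meredithRing s m).IsFactor 2 (F j))
    (hC : ∀ i : Fin m, ∃ j, ∃ C ∈ (F j).oddCycles, ∀ p ∈ V(C), p.1 = i) :
    ((m + 1 : ℕ) : ℕ∞) ≤ ∑ j, (F j).oddCycles.encard := by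
  have hloop : (meredithRing s m).Loopless := loopless_ring _ hm
  have hfin : ∀ j, (F j).oddCycles.Finite := by
    intro j
    have : Finite (Graph (Fin m × (Bool × ZMod 5)) ((Fin m × MeredithEdge s) ⊕ Fin m)) :=
      Finite.of_injective (fun G => (V(G), G.IsLink)) fun G H h =>
        Graph.ext (Prod.mk.inj h).1 fun e x y => by rw [(Prod.mk.inj h).2]
    exact Set.toFinite _
  have heven : ∀ j, Even (F j).oddCycles.ncard := by
    intro j
    have : (F j).Loopless := Loopless.anti (hF j).1.le
    refine (hF j).2.even_ncard_oddCycles ?_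
    have h1 : V(F j) = Set.univ := (hF j).1.vertexSet_eq
    rw [h1, Set.ncard_univ, Nat.card_prod, Nat.card_prod, Nat.card_eq_fintype_card (α := Bool),
      Fintype.card_bool]
    exact (even_two_mul _).mul_left _
  choose j C hCj hC using hC
  have hle : m ≤ ∑ j, (F j).oddCycles.ncard := by
    have : ∀ j, Finite (F j).oddCycles := fun j => hfin j
    have h1 := Nat.card_le_card_of_injective
      (fun i : Fin m => (⟨j i, C i, hCj i⟩ : Σ j, (F j).oddCycles)) (by
        intro i i' h
        obtain ⟨p, hp⟩ := (hCj i).2.1.1.1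
        have h2 : C i = C i' := by
          simp only [Sigma.mk.injEq] at h
          obtain ⟨h3, h4⟩ := h
          exact (Subtype.heq_iff_coe_eq (by rw [h3]; simp)).1 h4
        exact (hC i p hp).symm.trans (hC i' p (h2 ▸ hp)))
    rw [Nat.card_sigma, Nat.card_eq_fintype_card, Fintype.card_fin] at h1
    simpa [Nat.card_coe_set_eq] using h1
  have heven' : Even (∑ j, (F j).oddCycles.ncard) := Finset.even_sum _ fun j _ => heven j
  have hlt : m + 1 ≤ ∑ j, (F j).oddCycles.ncard := by
    refine Nat.lt_of_le_of_ne hle fun h => ?_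
    rw [← h] at heven'
    exact Nat.not_even_iff_odd.2 hodd heven'
  have hcast : ∑ j, (F j).oddCycles.encard = ((∑ j, (F j).oddCycles.ncard : ℕ) : ℕ∞) := by
    rw [Nat.cast_sum]
    exact Finset.sum_congr rfl fun j _ => (hfin j).cast_ncard_eq.symm
  rw [hcast]
  exact_mod_cast hlt

theorem Graph.IsFactor.ncard_inc {α β : Type*} {G F : Graph α β} {d : ℕ} {p : α} (hF : G.IsFactor d F)
    (hp : p ∈ V(G)) : {f | G.Inc f p ∧ f ∈ E(F)}.ncard = d := by
  rw [← hF.2 p (hF.1.vertexSet_eq ▸ hp), degree]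
  refine congrArg Set.ncard (Set.ext fun f => ?_)
  constructor
  · rintro ⟨h1, h2⟩
    exact (hF.1.le.inc_congr h2).2 h1
  · exact fun h => ⟨Inc.mono hF.1.le h, Inc.edge_mem h⟩

theorem exists_mem_oddCycles_of_five_cycle
    {F : Graph (Fin m × (Bool × ZMod 5)) ((Fin m × MeredithEdge s) ⊕ Fin m)}
    (hF : F ≤ meredithRing s m) {i : Fin m} {y : ZMod 5 → Bool × ZMod 5}
    {g : ZMod 5 → MeredithEdge s} (hy : Function.Injective y)
    (hg : ∀ l, .inl (i, g l) ∈ E(F) ∧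
      (meredithRing s m).IsLink (.inl (i, g l)) (i, y l) (i, y (l + 1))) :
    ∃ C ∈ F.oddCycles, ∀ p ∈ V(C), p.1 = i := by
  obtain ⟨C, hC, hV⟩ := exists_mem_oddCycles (G := F) (n := 5) (by decide) (by decide)
    (fun l => (i, y l)) ((Prod.mk_right_injective i).comp hy) (fun l => .inl (i, g l))
    fun l => (hF.isLink_iff (hg l).1).2 (hg l).2
  refine ⟨C, hC, fun p hp => ?_⟩
  rw [hV] at hp
  obtain ⟨l, rfl⟩ := hp
  rfl

theorem lt_evenOddness_meredithRing (hm : 2 ≤ m) (hodd : Odd m) :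
    ((m + 1 : ℕ) : ℕ∞) ≤ (meredithRing s m).evenOddness := by
  refine le_sInf ?_
  rintro _ ⟨n, F, hF, rfl⟩
  refine lt_sum_encard_oddCycles hm hodd hF.1 fun i => ?_
  obtain ⟨j, -, y, g, hy, hg⟩ := exists_five_cycle_of_decomposition (B := fun j => E(F j))
    (d := fun _ => 2) (fun _ => Or.inr rfl)
    (fun j p => IsFactor.ncard_inc (hF.1 j) (Set.mem_univ p.2)) hF.2 i
  exact ⟨j, exists_mem_oddCycles_of_five_cycle (hF.1 j).1.le hy hg⟩

theorem lt_evenOddness_deleteEdges_meredithRing (hm : 2 ≤ m) (hodd : Odd m)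
    {F₁ : Graph (Fin m × (Bool × ZMod 5)) ((Fin m × MeredithEdge s) ⊕ Fin m)}
    (hF₁ : (meredithRing s m).IsFactor 1 F₁) :
    ((m + 1 : ℕ) : ℕ∞) ≤ ((meredithRing s m).deleteEdges E(F₁)).evenOddness := by
  refine le_sInf ?_
  rintro _ ⟨n, F, hF, rfl⟩
  have hF' : ∀ j, (meredithRing s m).IsFactor 2 (F j) := fun j =>
    ⟨(hF.1 j).1.trans ⟨deleteEdges_le, rfl⟩, (hF.1 j).2⟩
  refine lt_sum_encard_oddCycles hm hodd hF' fun i => ?_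
  have hnot : ∀ {f}, f ∈ E(F₁) → ∀ j, f ∉ E(F j) := fun hf j hfj =>
    (IsSubgraph.edgeSet_mono (hF.1 j).1.le hfj).2 hf
  -- The removed 1-factor is kept as an additional class `none` of degree 1.
  obtain ⟨j, hj, y, g, hy, hg⟩ := exists_five_cycle_of_decomposition (s := s)
    (B := fun j : Option (Fin n) => j.elim E(F₁) fun j => E(F j))
    (d := fun j => j.elim 1 fun _ => 2) (by rintro (_ | j) <;> simp) (by
      rintro (_ | j) p
      · exact IsFactor.ncard_inc hF₁ (Set.mem_univ p.2)
      · exact IsFactor.ncard_inc (hF' j) (Set.mem_univ p.2)) (by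
      intro f hf
      by_cases h1 : f ∈ E(F₁)
      · refine ⟨none, h1, ?_⟩
        rintro (_ | j) hj
        · rfl
        · exact absurd hj (hnot h1 j)
      · obtain ⟨j, hj, hj'⟩ := hF.2 f ⟨hf, h1⟩
        refine ⟨some j, hj, ?_⟩
        rintro (_ | j') h
        · exact absurd h h1
        · exact congrArg some (hj' j' h)) i
  rcases j with _ | j
  · simp at hj
  · exact ⟨j, exists_mem_oddCycles_of_five_cycle (hF' j).1.le hy hg⟩

theorem maxDegree_meredithRing (hs : 3 ≤ s) : (meredithRing s m).maxDegree = s :=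
  (isRegular_ring _ (by decide) (isRegular_meredith hs)).maxDegree_eq
    ⟨(0, (false, 0)), Set.mem_univ _⟩

theorem lt_oddness_meredithRing (hs : 3 ≤ s) (hm : 2 ≤ m) (hodd : Odd m) :
    ((m + 1 : ℕ) : ℕ∞) ≤ (meredithRing s m).oddness := by
  rw [oddness, maxDegree_meredithRing hs]
  split_ifs
  · exact lt_evenOddness_meredithRing hm hodd
  · refine le_sInf ?_
    rintro _ ⟨F₁, hF₁, rfl⟩
    exact lt_evenOddness_deleteEdges_meredithRing hm hodd hF₁

theorem le_resistance_meredithRing (hs : 3 ≤ s) :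
    ((m : ℕ) : ℕ∞) ≤ (meredithRing s m).resistance := by
  refine le_sInf ?_
  rintro _ ⟨F, -, hc, rfl⟩
  rw [maxDegree_meredithRing hs] at hc
  choose g hg using exists_mem_of_edgeColorable hs hc
  have hinj : Function.Injective fun i => (Sum.inl (i, g i) : (Fin m × MeredithEdge s) ⊕ Fin m) :=
    fun i j h => by simpa using (congrArg Prod.fst (Sum.inl_injective h))
  have h1 : (Set.range fun i => (Sum.inl (i, g i) : (Fin m × MeredithEdge s) ⊕ Fin m)) ⊆ F := by
    rintro _ ⟨i, rfl⟩
    exact hg i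
  refine le_trans ?_ (Set.encard_le_encard h1)
  rw [← Set.image_univ, hinj.encard_image, Set.encard_univ, ENat.card_eq_coe_fintype_card,
    Fintype.card_fin]

/-! ### A coloring after deleting one edge per copy -/

/-- A color in `{0, 1, 2}` for every edge of the Meredith graph that belongs to the Petersen graph,
and different further colors for the additional copies of the spokes. -/
def petersenColor (s : ℕ) : MeredithEdge s → ℕ
  | .inl p =>
    if p = s((false, 1), (false, 2)) ∨ p = s((false, 3), (false, 4)) ∨
      p = s((true, 3), (true, 0)) ∨ p = s((true, 4), (true, 1)) then 1
    else if p = s((false, 2), (false, 3)) ∨ p = s((false, 4), (false, 0)) ∨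
      p = s((true, 1), (true, 3)) ∨ p = s((true, 2), (true, 4)) then 0
    else 2
  | .inr (_, c) => c.val + 3

/-- The colors of the edges at the vertex `x` in the Meredith graph, where `outerEdge s 0` is
colored differently at its two ends. -/
def localColor (s : ℕ) (x : Bool × ZMod 5) (g : MeredithEdge s) : ℕ :=
  if g = outerEdge s 0 then (if x = (false, 0) then 1 else 0) else petersenColor s g

/-- The multiplicity index of a copy of a spoke. -/
def spokeIndex {s : ℕ} : Option (Fin (s - 3)) → ℕ
  | none => 0
  | some c => c.val + 1

theorem spokeIndex_injective : Function.Injective (spokeIndex (s := s)) := by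
  rintro (_ | c) (_ | d) h <;> simp_all [spokeIndex, Fin.ext_iff]

theorem localColor_spokeEdge (x : Bool × ZMod 5) (i : ZMod 5) (c : Option (Fin (s - 3))) :
    localColor s x (spokeEdge s i c) = spokeIndex c + 2 := by
  rw [localColor, if_neg (outerEdge_ne_spokeEdge _ _ _).symm]
  rcases c with _ | c
  · simp only [spokeEdge, petersenColor, spokeIndex]
    revert i
    decide
  · rfl

/-- Sum 1 says that the two outer edges at a vertex have the colors 0 and 1; all spokes have colors
at least 2. -/
theorem localColor_outerEdge (i : ZMod 5) :
    localColor s (false, i) (outerEdge s i) + localColor s (false, i) (outerEdge s (i - 1)) = 1 := by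
  have h1 : ∀ j : ZMod 5, localColor s (false, i) (outerEdge s j) =
      if j = 0 then (if i = 0 then 1 else 0)
      else petersenColor 0 (outerEdge 0 j) := by
    intro j
    by_cases hj : j = 0
    · simp [localColor, hj]
    · rw [localColor, if_neg fun h => hj (outerEdge_injective s h), if_neg hj]
      rfl
  rw [h1, h1]
  clear h1
  revert i
  decide

/-- The excluded positions 0 and 2 are the ends of `innerEdge s 0`, the edge to be deleted, which
shares color 2 with spokes. -/
theorem localColor_innerEdge (i : ZMod 5) (h0 : i ≠ 0) (h2 : i ≠ 2) :
    localColor s (true, i) (innerEdge s i) + localColor s (true, i) (innerEdge s (i - 2)) = 1 := by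
  have h1 : ∀ j : ZMod 5, localColor s (true, i) (innerEdge s j) =
      petersenColor 0 (innerEdge 0 j) := by
    intro j
    rw [localColor, if_neg (outerEdge_ne_innerEdge _ _).symm]
    rfl
  rw [h1, h1]
  clear h1
  revert i
  decide

theorem localColor_innerEdge_lt (x : Bool × ZMod 5) (i : ZMod 5) (h0 : i ≠ 0) :
    localColor s x (innerEdge s i) < 2 := by
  rw [localColor, if_neg (outerEdge_ne_innerEdge _ _).symm]
  change petersenColor 0 (innerEdge 0 i) < 2
  revert i
  decide

theorem localColor_injOn {x : Bool × ZMod 5} {g g' : MeredithEdge s}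
    (hg : (meredith s).Inc g x) (hg' : (meredith s).Inc g' x) (h0 : g ≠ innerEdge s 0)
    (h0' : g' ≠ innerEdge s 0) (h : localColor s x g = localColor s x g') : g = g' := by
  obtain ⟨_ | _, i⟩ := x
  · have h1 := localColor_outerEdge (s := s) i
    rcases meredith_inc_false.1 hg with rfl | rfl | ⟨c, rfl⟩ <;>
      rcases meredith_inc_false.1 hg' with rfl | rfl | ⟨d, rfl⟩ <;>
      try rw [localColor_spokeEdge] at h
    all_goals try rw [localColor_spokeEdge] at h
    all_goals first | rfl | (exfalso; omega) | skip
    rw [spokeIndex_injective (by omega : spokeIndex c = spokeIndex d)]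
  · have h1 := localColor_innerEdge (s := s) i
    have h2 : ∀ {j}, innerEdge s j ≠ innerEdge s 0 → localColor s (true, i) (innerEdge s j) < 2 :=
      fun hj => localColor_innerEdge_lt _ _ fun h => hj (by rw [h])
    have h3 : ∀ {g g'}, (g = innerEdge s i ∧ g' = innerEdge s (i - 2)) → g ≠ innerEdge s 0 →
        g' ≠ innerEdge s 0 → localColor s (true, i) g ≠ localColor s (true, i) g' := by
      rintro g g' ⟨rfl, rfl⟩ h4 h5 h6
      have := h1 (fun h => h4 (by rw [h])) (fun h => h5 (by rw [h, sub_self]))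
      omega
    rcases meredith_inc_true.1 hg with rfl | rfl | ⟨c, rfl⟩ <;>
      rcases meredith_inc_true.1 hg' with rfl | rfl | ⟨d, rfl⟩
    · rfl
    · exact absurd h (h3 ⟨rfl, rfl⟩ h0 h0')
    · have := h2 h0
      rw [localColor_spokeEdge] at h
      omega
    · exact absurd h.symm (h3 ⟨rfl, rfl⟩ h0' h0)
    · rfl
    · have := h2 h0
      rw [localColor_spokeEdge] at h
      omega
    · have := h2 h0'
      rw [localColor_spokeEdge] at h
      omega
    · have := h2 h0'
      rw [localColor_spokeEdge] at h
      omega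
    · rw [localColor_spokeEdge, localColor_spokeEdge] at h
      rw [spokeIndex_injective (by omega : spokeIndex c = spokeIndex d)]

theorem petersenColor_lt (hs : 3 ≤ s) (g : MeredithEdge s) : petersenColor s g < s := by
  rcases g with p | ⟨p, c⟩
  · unfold petersenColor
    dsimp only
    split_ifs <;> omega
  · have := c.2
    change c.val + 3 < s
    omega

theorem exists_perm_apply_eq {α : Type*} [DecidableEq α] {a b p q : α} (hab : a ≠ b)
    (hpq : p ≠ q) : ∃ σ : Equiv.Perm α, σ a = p ∧ σ b = q := by
  have h1 : Equiv.swap a p b ≠ p := fun h =>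
    hab ((Equiv.swap a p).injective (by rw [h, Equiv.swap_apply_left]))
  refine ⟨Equiv.swap (Equiv.swap a p b) q * Equiv.swap a p, ?_, ?_⟩
  · rw [Equiv.Perm.mul_apply, Equiv.swap_apply_left, Equiv.swap_apply_of_ne_of_ne h1.symm hpq]
  · rw [Equiv.Perm.mul_apply, Equiv.swap_apply_left]

/-- A proper coloring with three colors of the edges of a cycle. -/
theorem exists_cyclic_coloring (hm : 2 ≤ m) (hs : 3 ≤ s) :
    ∃ a : Fin m → Fin s, ∀ i, a i ≠ a (i + 1) := by
  -- The colors 0 and 1 alternate, and the last position gets color 2, so that the parity of `m` is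
  -- irrelevant.
  refine ⟨fun i => ⟨if i.val + 1 = m then 2 else i.val % 2, by split_ifs <;> omega⟩, ?_⟩
  intro i h
  have hi := i.2
  have h1 : (i + 1).val = if i.val + 1 = m then 0 else i.val + 1 := by
    rw [Fin.val_add, Fin.val_one', Nat.mod_eq_of_lt (show 1 < m by omega)]
    split_ifs with h2
    · rw [h2, Nat.mod_self]
    · exact Nat.mod_eq_of_lt (by omega)
  simp only [Fin.mk.injEq, h1] at h
  split_ifs at h <;> omega

theorem resistance_meredithRing_le (hs : 3 ≤ s) (hm : 2 ≤ m) :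
    (meredithRing s m).resistance ≤ ((m : ℕ) : ℕ∞) := by
  classical
  set F : Set ((Fin m × MeredithEdge s) ⊕ Fin m) :=
    Set.range fun i : Fin m => .inl (i, innerEdge s 0) with hF
  refine sInf_le ⟨F, ?_, ?_, ?_⟩
  · rintro _ ⟨i, rfl⟩
    exact (inl_mem_edgeSet_ring _).2
      ⟨(meredith_isLink_innerEdge 0).edge_mem, (outerEdge_ne_innerEdge _ _).symm⟩
  · rw [maxDegree_meredithRing hs]
    obtain ⟨a, ha⟩ := exists_cyclic_coloring (s := s) hm hs
    set idx : Fin m → Bool × ZMod 5 → Fin m :=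
      fun i x => if (i, x) = ringStart (false, 0) (false, 1) i then i else i - 1 with hidx
    have hne : ∀ i, a (idx i (false, 0)) ≠ a (idx i (false, 1)) := by
      intro i
      have h1 := ha (i - 1)
      rw [sub_add_cancel] at h1
      rcases ringStart_ringEnd ((false, 0) : Bool × ZMod 5) (false, 1) i with ⟨h2, -⟩ | ⟨h2, -⟩
      · simp only [hidx, h2, if_true]
        rw [if_neg (by simpa using show (1 : ZMod 5) ≠ 0 by decide)]
        exact h1.symm
      · simp only [hidx, h2, if_true]
        rw [if_neg (by simpa using show (0 : ZMod 5) ≠ 1 by decide)]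
        exact h1
    have h01 : (⟨1, by omega⟩ : Fin s) ≠ ⟨0, by omega⟩ := by simp
    -- In each copy the colors are permuted so that 1 and 0, the colors of `outerEdge s 0` at its
    -- two ends, become the distinct colors of the connecting edges there.
    choose σ hσ1 hσ0 using fun i => exists_perm_apply_eq h01 (hne i)
    set col : (Fin m × MeredithEdge s) ⊕ Fin m → Fin s := fun f =>
      f.elim (fun p => σ p.1 ⟨petersenColor s p.2, petersenColor_lt hs _⟩) a with hcol
    have hlt : ∀ x g, localColor s x g < s := by
      intro x g
      unfold localColor
      split_ifs
      · omega
      · omega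
      · exact petersenColor_lt hs g
    have hlocal : ∀ i x g, (meredith s).Inc g x →
        col (copyEdge (outerEdge s 0) (false, 0) (false, 1) i x g) =
          σ i ⟨localColor s x g, hlt x g⟩ := by
      intro i x g hg
      by_cases hge : g = outerEdge s 0
      · subst hge
        have h1 : copyEdge (outerEdge s 0) (false, 0) (false, 1) i x (outerEdge s 0) =
            .inr (idx i x) := by
          rw [copyEdge, if_pos rfl]
          simp only [hidx]
          split_ifs <;> rfl
        rw [h1]
        rcases meredith_inc_outerEdge_zero.1 hg with rfl | rfl
        · refine (hσ1 i).symm.trans (congrArg _ (Fin.ext ?_))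
          simp [localColor]
        · refine (hσ0 i).symm.trans (congrArg _ (Fin.ext ?_))
          simp [localColor, show (1 : ZMod 5) ≠ 0 by decide]
      · rw [copyEdge_of_ne hge]
        refine congrArg (σ i) (Fin.ext ?_)
        simp [localColor, hge]
    refine ⟨fun f => col f, ?_⟩
    rintro ⟨f, hf⟩ ⟨f', hf'⟩ ⟨i, x⟩ hne hfx hfx' heq
    obtain ⟨hfx, hfF⟩ := deleteEdges_inc.1 hfx
    obtain ⟨hfx', hfF'⟩ := deleteEdges_inc.1 hfx'
    obtain ⟨g, hg, rfl⟩ := (ring_inc_iff _ (by decide)).1 hfx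
    obtain ⟨g', hg', rfl⟩ := (ring_inc_iff _ (by decide)).1 hfx'
    have h0 : ∀ {g}, copyEdge (outerEdge s 0) (false, 0) (false, 1) i x g ∉ F →
        g ≠ innerEdge s 0 := by
      rintro g hg rfl
      exact hg ⟨i, (copyEdge_of_ne (outerEdge_ne_innerEdge _ _).symm).symm⟩
    dsimp only at heq
    rw [hlocal i x g hg, hlocal i x g' hg'] at heq
    have h1 := congrArg Fin.val ((σ i).injective heq)
    exact hne (Subtype.ext (congrArg (copyEdge _ _ _ i x)
      (localColor_injOn hg hg' (h0 hfF) (h0 hfF') h1)))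
  · have hinj : Function.Injective
        fun i : Fin m => (Sum.inl (i, innerEdge s 0) : (Fin m × MeredithEdge s) ⊕ Fin m) :=
      fun i j h => by simpa using (congrArg Prod.fst (Sum.inl_injective h))
    rw [hF, ← Set.image_univ, hinj.encard_image, Set.encard_univ, ENat.card_eq_coe_fintype_card,
      Fintype.card_fin]

end bounds

/-! ### A 2-factorization with at most m + 1 odd cycles -/

section upper

variable {s m : ℕ} [NeZero m]

open Classical in
/-- The index of the 2-factor which contains a given edge of the Meredith graph: the edges of the
two 5-cycles have index `0`, and the copies of the spokes are grouped in pairs. -/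
noncomputable def factorIndex : MeredithEdge s → ℕ
  | .inl p => if ∃ i : ZMod 5, p = s((false, i), (true, i)) then 1 else 0
  | .inr (_, c) => (c.val + 1) / 2 + 1

theorem factorIndex_outerEdge (i : ZMod 5) : factorIndex (outerEdge s i) = 0 := by
  simp [factorIndex, outerEdge]

theorem factorIndex_innerEdge (i : ZMod 5) : factorIndex (innerEdge s i) = 0 := by
  simp [factorIndex, innerEdge]

theorem factorIndex_spokeEdge (i : ZMod 5) (c : Option (Fin (s - 3))) :
    factorIndex (spokeEdge s i c) = spokeIndex c / 2 + 1 := by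
  rcases c with _ | c
  · simp [factorIndex, spokeEdge, spokeIndex]
  · rfl

/-- The extension of `factorIndex` to `meredithRing`. -/
noncomputable def ringFactorIndex : (Fin m × MeredithEdge s) ⊕ Fin m → ℕ
  | .inl p => factorIndex p.2
  | .inr _ => 0

theorem ringFactorIndex_copyEdge (i : Fin m) (x : Bool × ZMod 5) (g : MeredithEdge s) :
    ringFactorIndex (copyEdge (outerEdge s 0) (false, 0) (false, 1) i x g) = factorIndex g := by
  by_cases hg : g = outerEdge s 0
  · rw [hg, factorIndex_outerEdge, copyEdge, if_pos rfl, ringFactorIndex]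
  · rw [copyEdge_of_ne hg, ringFactorIndex]

/-- The factors of `meredithRing` given by `ringFactorIndex`. -/
noncomputable def ringFactor (s m : ℕ) [NeZero m] (q : ℕ) :
    Graph (Fin m × (Bool × ZMod 5)) ((Fin m × MeredithEdge s) ⊕ Fin m) :=
  (meredithRing s m).restrict {f | ringFactorIndex f = q}

theorem degree_ringFactor (q : ℕ) (i : Fin m) (x : Bool × ZMod 5) :
    (ringFactor s m q).degree (i, x) =
      {g | (meredith s).Inc g x ∧ g ∈ {g | factorIndex g = q}}.ncard := by
  have h1 := ncard_ring_inc (isSimpleEdge_outerEdge (s := s)).1 (by decide)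
    {f | ringFactorIndex f = q} i x
  simp only [Set.mem_ofPred_eq, ringFactorIndex_copyEdge] at h1
  exact (congrArg Set.ncard (Set.ext fun f => restrict_inc)).trans h1

theorem isRegular_ringFactor_zero : (ringFactor s m 0).IsRegular 2 := by
  rintro ⟨i, ⟨_ | _, j⟩⟩ -
  · rw [degree_ringFactor, ncard_inc_false]
    simp [outerCount, spokeCount, factorIndex_outerEdge, factorIndex_spokeEdge]
  · rw [degree_ringFactor, ncard_inc_true]
    simp [innerCount, spokeCount, factorIndex_innerEdge, factorIndex_spokeEdge]

theorem degree_ringFactor_succ (q : ℕ) (p : Fin m × (Bool × ZMod 5)) :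
    (ringFactor s m (q + 1)).degree p =
      {c : Option (Fin (s - 3)) | spokeIndex c / 2 = q}.ncard := by
  obtain ⟨i, ⟨_ | _, j⟩⟩ := p
  · rw [degree_ringFactor, ncard_inc_false]
    simp [outerCount, spokeCount, factorIndex_outerEdge, factorIndex_spokeEdge]
  · rw [degree_ringFactor, ncard_inc_true]
    simp [innerCount, spokeCount, factorIndex_innerEdge, factorIndex_spokeEdge]

theorem spokeIndex_lt (hs : 3 ≤ s) (c : Option (Fin (s - 3))) : spokeIndex c < s - 2 := by
  rcases c with _ | c
  · simp only [spokeIndex]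
    omega
  · have := c.2
    simp only [spokeIndex]
    omega

theorem exists_spokeIndex_eq {n : ℕ} (hn : n < s - 2) :
    ∃ c : Option (Fin (s - 3)), spokeIndex c = n := by
  rcases n with _ | n
  · exact ⟨none, rfl⟩
  · exact ⟨some ⟨n, by omega⟩, rfl⟩

theorem image_spokeIndex (hs : 3 ≤ s) (q : ℕ) :
    spokeIndex '' {c : Option (Fin (s - 3)) | spokeIndex c / 2 = q} =
      {n | n < s - 2 ∧ n / 2 = q} := by
  ext n
  constructor
  · rintro ⟨c, hc, rfl⟩
    exact ⟨spokeIndex_lt hs c, hc⟩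
  · rintro ⟨h1, h2⟩
    obtain ⟨c, rfl⟩ := exists_spokeIndex_eq h1
    exact ⟨c, h2, rfl⟩

theorem isRegular_ringFactor_succ (hs : 3 ≤ s) {q : ℕ} (hq : q < (s - 2) / 2) :
    (ringFactor s m (q + 1)).IsRegular 2 := by
  intro p _
  rw [degree_ringFactor_succ, ← Set.ncard_image_of_injective _ spokeIndex_injective,
    image_spokeIndex hs, show {n | n < s - 2 ∧ n / 2 = q} = {2 * q, 2 * q + 1} by ext n; simp; omega,
    Set.ncard_pair (by omega)]

theorem isRegular_ringFactor_last (hs : 3 ≤ s) (hodd : Odd s) :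
    (ringFactor s m ((s - 2) / 2 + 1)).IsRegular 1 := by
  intro p _
  obtain ⟨r, rfl⟩ := hodd
  rw [degree_ringFactor_succ, ← Set.ncard_image_of_injective _ spokeIndex_injective,
    -- The spoke indices are 0, ..., `s - 3`; for odd `s` the last one, `2 * r - 2`, has no partner.
    image_spokeIndex hs, show {n | n < 2 * r + 1 - 2 ∧ n / 2 = (2 * r + 1 - 2) / 2} = {2 * r - 2} by
      ext n; simp; omega,
    Set.ncard_singleton]

theorem ringFactorIndex_lt (hs : 3 ≤ s) {f : (Fin m × MeredithEdge s) ⊕ Fin m}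
    (hf : f ∈ E(meredithRing s m)) :
    ringFactorIndex f < (s - 2) / 2 + 1 ∨ Odd s ∧ ringFactorIndex f = (s - 2) / 2 + 1 := by
  rcases f with ⟨i, g⟩ | i
  · rcases mem_edgeSet_meredith.1 ((inl_mem_edgeSet_ring _).1 hf).1 with
      ⟨j, rfl⟩ | ⟨j, rfl⟩ | ⟨j, c, rfl⟩
    · left
      rw [ringFactorIndex, factorIndex_outerEdge]
      omega
    · left
      rw [ringFactorIndex, factorIndex_innerEdge]
      omega
    · have := spokeIndex_lt hs c
      rw [ringFactorIndex, factorIndex_spokeEdge, Nat.odd_iff]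
      omega
  · left
    rw [ringFactorIndex]
    omega

/-- The labels are `some i` for the inner pentagon of copy `i` and `none` for the long cycle formed
by the outer paths and the connecting edges. -/
theorem encard_oddCycles_ringFactor_zero :
    (ringFactor s m 0).oddCycles.encard ≤ ((m + 1 : ℕ) : ℕ∞) := by
  have hr : ∀ {i : Fin m} {g x y}, (meredith s).IsLink g x y → g ≠ outerEdge s 0 →
      factorIndex g = 0 → (ringFactor s m 0).Adj (i, x) (i, y) := fun hg hne h0 =>
    ⟨.inl (_, _), h0, (ring_isLink_inl_mk _).2 ⟨hg, hne⟩⟩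
  have hf : ∀ (i : Fin m) (j : ZMod 5),
      Relation.ReflTransGen (ringFactor s m 0).Adj (i, (false, 1)) (i, (false, j)) := by
    intro i
    have h1 : ∀ j ≠ 0, (ringFactor s m 0).Adj (i, (false, j)) (i, (false, j + 1)) := fun j hj =>
      hr (meredith_isLink_outerEdge j) (fun h => hj (outerEdge_injective s h))
        (factorIndex_outerEdge j)
    have a2 : Relation.ReflTransGen (ringFactor s m 0).Adj (i, (false, 1)) (i, (false, 2)) :=
      .single (h1 1 (by decide))
    have a3 : Relation.ReflTransGen (ringFactor s m 0).Adj (i, (false, 1)) (i, (false, 3)) :=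
      a2.tail (h1 2 (by decide))
    have a4 : Relation.ReflTransGen (ringFactor s m 0).Adj (i, (false, 1)) (i, (false, 4)) :=
      a3.tail (h1 3 (by decide))
    have a0 : Relation.ReflTransGen (ringFactor s m 0).Adj (i, (false, 1)) (i, (false, 0)) :=
      a4.tail (h1 4 (by decide))
    exact forall_zmod_five.2 ⟨a0, .refl, a2, a3, a4⟩
  have ht : ∀ (i : Fin m) (j : ZMod 5),
      Relation.ReflTransGen (ringFactor s m 0).Adj (i, (true, 0)) (i, (true, j)) := by
    intro i
    have h1 : ∀ j, (ringFactor s m 0).Adj (i, (true, j)) (i, (true, j + 2)) := fun j =>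
      hr (meredith_isLink_innerEdge j) (outerEdge_ne_innerEdge _ _).symm (factorIndex_innerEdge j)
    have a2 : Relation.ReflTransGen (ringFactor s m 0).Adj (i, (true, 0)) (i, (true, 2)) :=
      .single (h1 0)
    have a4 : Relation.ReflTransGen (ringFactor s m 0).Adj (i, (true, 0)) (i, (true, 4)) :=
      a2.tail (h1 2)
    have a1 : Relation.ReflTransGen (ringFactor s m 0).Adj (i, (true, 0)) (i, (true, 1)) :=
      a4.tail (h1 4)
    have a3 : Relation.ReflTransGen (ringFactor s m 0).Adj (i, (true, 0)) (i, (true, 3)) :=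
      a1.tail (h1 1)
    exact forall_zmod_five.2 ⟨.refl, a1, a2, a3, a4⟩
  have hstart : ∀ i : Fin m, Relation.ReflTransGen (ringFactor s m 0).Adj
      (ringStart (false, 0) (false, 1) 0) (ringStart (false, 0) (false, 1) i) := by
    refine fun i => ring_rel_of_forall (fun _ _ _ h1 h2 => h1.trans h2)
      (fun i => .single ⟨.inr i, rfl, ring_isLink_ringStart _ i⟩) (fun j => ?_) 0 i
    rcases ringStart_ringEnd ((false, 0) : Bool × ZMod 5) (false, 1) j with ⟨h1, h2⟩ | ⟨h1, h2⟩ <;>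
      rw [h1, h2]
    · exact hf j 0
    · exact reflTransGen_adj_symm (hf j 0)
  have houter : ∀ (i : Fin m) (j : ZMod 5), Relation.ReflTransGen (ringFactor s m 0).Adj
      (ringStart (false, 0) (false, 1) 0) (i, (false, j)) := by
    intro i j
    refine (hstart i).trans ?_
    rcases ringStart_eq_or ((false, 0) : Bool × ZMod 5) (false, 1) i with h | h <;> rw [h]
    · exact (reflTransGen_adj_symm (hf i 0)).trans (hf i j)
    · exact hf i j
  have h1 := isRegular_ringFactor_zero (s := s) (m := m).encard_oddCycles_le
    (fun p : Fin m × (Bool × ZMod 5) => if p.2.1 then some p.1 else none) (by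
      rintro ⟨i, ⟨_ | _, j⟩⟩ - ⟨i', ⟨_ | _, j'⟩⟩ - h
      · exact (reflTransGen_adj_symm (houter i j)).trans (houter i' j')
      · simp at h
      · simp at h
      · obtain rfl : i = i' := by simpa using h
        exact (reflTransGen_adj_symm (ht i j)).trans (ht i j'))
  rw [ENat.card_eq_coe_fintype_card, Fintype.card_option, Fintype.card_fin] at h1
  exact h1

/-- Paired copies of a spoke have consecutive indices, so the parity of the index is a proper
2-coloring of the factor, which excludes odd cycles. -/
theorem oddCycles_ringFactor_succ (hm : 2 ≤ m) (q : ℕ) :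
    (ringFactor s m (q + 1)).oddCycles = ∅ := by
  have : (meredithRing s m).Loopless := loopless_ring _ hm
  have : (ringFactor s m (q + 1)).Loopless := Loopless.anti restrict_le
  have hspoke : ∀ {x g}, (meredith s).Inc g x → factorIndex g = q + 1 →
      ∃ c, g = spokeEdge s x.2 c ∧ spokeIndex c / 2 = q := by
    rintro ⟨_ | _, j⟩ g hg h
    · rcases meredith_inc_false.1 hg with rfl | rfl | ⟨c, rfl⟩
      · simp [factorIndex_outerEdge] at h
      · simp [factorIndex_outerEdge] at h
      · exact ⟨c, rfl, by simpa [factorIndex_spokeEdge] using h⟩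
    · rcases meredith_inc_true.1 hg with rfl | rfl | ⟨c, rfl⟩
      · simp [factorIndex_innerEdge] at h
      · simp [factorIndex_innerEdge] at h
      · exact ⟨c, rfl, by simpa [factorIndex_spokeEdge] using h⟩
  set par : (Fin m × MeredithEdge s) ⊕ Fin m → Fin 2 := fun f =>
    f.elim (fun p => p.2.elim (fun _ => 0) fun r => Fin.ofNat 2 (r.2.val + 1)) fun _ => 0 with hpar
  have hparc : ∀ i j c, (par (.inl (i, spokeEdge s j c))).val = spokeIndex c % 2 := by
    rintro i j (_ | c) <;> simp [hpar, spokeEdge, spokeIndex]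
  refine EdgeColorable.oddCycles_eq_empty ⟨fun f => par f, ?_⟩
  rintro ⟨f, hf⟩ ⟨f', hf'⟩ ⟨i, x⟩ hne hfx hfx' heq
  obtain ⟨hfx, hq⟩ := restrict_inc.1 hfx
  obtain ⟨hfx', hq'⟩ := restrict_inc.1 hfx'
  obtain ⟨g, hg, rfl⟩ := (ring_inc_iff _ (by decide)).1 hfx
  obtain ⟨g', hg', rfl⟩ := (ring_inc_iff _ (by decide)).1 hfx'
  simp only [Set.mem_ofPred_eq, ringFactorIndex_copyEdge] at hq hq'
  obtain ⟨c, rfl, hc⟩ := hspoke hg hq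
  obtain ⟨c', rfl, hc'⟩ := hspoke hg' hq'
  have h1 := congrArg Fin.val heq
  simp only [copyEdge_of_ne (outerEdge_ne_spokeEdge _ _ _).symm, hparc] at h1
  have h2 : c = c' := spokeIndex_injective (by omega)
  subst h2
  exact hne rfl

theorem sum_encard_oddCycles_ringFactor (hm : 2 ≤ m) (n : ℕ) :
    ∑ q : Fin (n + 1), (ringFactor s m q).oddCycles.encard ≤ ((m + 1 : ℕ) : ℕ∞) := by
  rw [Fin.sum_univ_succ, Finset.sum_eq_zero, add_zero]
  · exact encard_oddCycles_ringFactor_zero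
  · intro q _
    rw [Fin.val_succ, oddCycles_ringFactor_succ hm, Set.encard_empty]

theorem isRegular_ringFactor (hs : 3 ≤ s) (q : Fin ((s - 2) / 2 + 1)) :
    (ringFactor s m q).IsRegular 2 := by
  obtain ⟨_ | q, hq⟩ := q
  · exact isRegular_ringFactor_zero
  · exact isRegular_ringFactor_succ hs (by omega)

theorem oddness_meredithRing_le (hs : 3 ≤ s) (hm : 2 ≤ m) :
    (meredithRing s m).oddness ≤ ((m + 1 : ℕ) : ℕ∞) := by
  rw [oddness, maxDegree_meredithRing hs]
  refine le_trans ?_ (sum_encard_oddCycles_ringFactor (s := s) hm ((s - 2) / 2))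
  split_ifs with heven
  · refine sInf_le ⟨_, fun q : Fin ((s - 2) / 2 + 1) => ringFactor s m q, ⟨fun q => ?_, ?_⟩, rfl⟩
    · exact ⟨⟨restrict_le, rfl⟩, isRegular_ringFactor hs q⟩
    · intro f hf
      have h1 := (ringFactorIndex_lt hs hf).resolve_right fun h => Nat.not_even_iff_odd.2 h.1 heven
      exact ⟨⟨_, h1⟩, ⟨hf, rfl⟩, fun q hq => Fin.ext hq.2.symm⟩
  -- For odd `s`, the unpaired copies of the spokes form the 1-factor to be removed.
  · set F₁ := ringFactor s m ((s - 2) / 2 + 1)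
    have hF₁ : (meredithRing s m).IsFactor 1 F₁ :=
      ⟨⟨restrict_le, rfl⟩, isRegular_ringFactor_last hs (Nat.not_even_iff_odd.1 heven)⟩
    refine le_trans (sInf_le ⟨F₁, hF₁, rfl⟩) ?_
    refine sInf_le ⟨_, fun q : Fin ((s - 2) / 2 + 1) => ringFactor s m q, ⟨fun q => ?_, ?_⟩, rfl⟩
    · refine ⟨⟨⟨fun x hx => hx, ?_⟩, rfl⟩, isRegular_ringFactor hs q⟩
      rintro f x y ⟨h1, h2⟩
      refine ⟨h2, fun h3 => ?_⟩
      have h4 : ringFactorIndex f = q := h1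
      have h5 : ringFactorIndex f = (s - 2) / 2 + 1 := h3.2
      have := q.2
      omega
    · rintro f ⟨hf, hf1⟩
      have h1 := (ringFactorIndex_lt hs hf).resolve_right fun h => hf1 ⟨hf, h.2⟩
      exact ⟨⟨_, h1⟩, ⟨hf, rfl⟩, fun q hq => Fin.ext hq.2.symm⟩

end upper

theorem mainTheorem4 (k s : ℕ) (hk : 1 ≤ k) (hs : 3 ≤ s) :
    ∃ (M : petersenGraph.Subgraph) (v w : Bool × ZMod 5)
      (e : Sym2 (Bool × ZMod 5) ⊕ (Sym2 (Bool × ZMod 5) × Fin (s - 3)))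
      (he : (meredithGraph s M).IsSimpleEdge e v w)
      (O : Graph (Fin (2 * k + 1) × (Bool × ZMod 5))
        ((Fin (2 * k + 1) × (Sym2 (Bool × ZMod 5) ⊕ (Sym2 (Bool × ZMod 5) × Fin (s - 3)))) ⊕
          Fin (2 * k + 1))),
      M.IsPerfectMatching ∧
      O = Graph.glue (fun _ => meredithGraph s M) (fun _ => e) (fun _ => v) (fun _ => w)
        (fun _ => he.1) ∧
      O.Connected ∧
      O.IsSGraph s ∧
      O.resistance = ((2 * k + 1 : ℕ) : ℕ∞) ∧
      O.oddness = ((2 * k + 2 : ℕ) : ℕ∞) := by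
  have hm : 2 ≤ 2 * k + 1 := by omega
  refine ⟨petersenSpokes, (false, 0), (false, 1), outerEdge s 0, isSimpleEdge_outerEdge,
    meredithRing s (2 * k + 1), petersenSpokes_isPerfectMatching, rfl,
    connected_ring _ connected_deleteEdges_meredith,
    isSGraph_ring _ hm (isSGraph_meredith hs) connected_deleteEdges_meredith,
    (resistance_meredithRing_le hs hm).antisymm (le_resistance_meredithRing hs),
    (oddness_meredithRing_le hs hm).antisymm (lt_oddness_meredithRing hs hm ⟨k, rfl⟩)⟩
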